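/- **Setting.** There are $K\ge 1$ sellers. The per-sample costs $c_1,\dots,c_K$ are i.i.d. with density $f$ and c.d.f. $F$ on $[c_{\min},c_{\max}]$, $0<c_{\min}<c_{\max}$; the virtual cost is $\psi(c)=c+F(c)/f(c)$. Independently across sellers and of the costs, seller $i$'s data has standard deviation $\sigma_i=\sigma_L$ with probability $\mu$ and $\sigma_i=\sigma_H>\sigma_L$ with probability $1-\mu$; its samples are i.i.d. $N(\theta,\sigma_i^2)$. Before $(c_i,\sigma_i)$ are realized, each seller commits to a number $m_i\in\{0,2,3,\dots,M\}$ of free samples. The buyer forms a posterior belief about each $\sigma_i^2$ by Bayes' rule from the sample variance of the $m_i$ free samples (for $m_i=0$ it is the prior); let $\bar\sigma_i^2$ be the mean of $\sigma_i^2$ under this belief. The buyer then runs a direct mechanism $(\mathbf n,\mathbf t)$, which, given the reported costs, determines the integer numbers $n_i\geq 0$ of samples purchased (possibly at random) and the payments $t_i$. Seller $i$'s utility is $t_i-n_ic_i$. The buyer's cost is $\min_{w}\sum_i w_i^2\bar\sigma_i^2/n_i+\lambda\sum_i t_i$ with $\lambda>0$, the minimum being over $w\ge 0$ with $\sum_i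 w_i=1$ (a term with $n_i=0$ is $0$ if $w_i=0$ and $+\infty$ otherwise). For a given belief profile, a mechanism is *feasible* if it is Bayesian incentive compatible and interim individually rational; it is a *$\zeta$-approximate solution* if it is feasible and its expected buyer cost is at most $1+\zeta$ times that of every feasible mechanism. A free-sample profile $\mathbf m$ together with a buyer strategy, which assigns a mechanism to each belief profile, is a *$\zeta$-approximate subgame perfect equilibrium* if the assigned mechanism is a $\zeta$-approximate solution at every belief profile, and no seller can increase its ex-ante expected utility (over costs, qualities and free samples, with costs reported truthfully) by unilaterally changing $m_i$ to another element of $\{0,2,3,\dots,M\}$. The *single-sourcing mechanism* selects a seller $i^*$ uniformly at random from $\operatorname{argmin}_i\bar\sigma_i^2\psi(c_i)$, purchases $\big\lfloor \bar\sigma_{i^*}/\sqrt{\lambda\psi(c_{i^*})}\big\rfloor$ samples from $i^*$ and none from the others, and pays each seller $i$ the Myerson payment $c_i\,\bar n_i(\mathbf c)+\int_{c_i}^{c_{\max}}\bar n_i(s,\mathbf c_{-i})\,ds$, where $\mathbf c$ are the reported costs and $\bar n_i(\mathbf c)$ is the expected number of samples purchased from $i$ (over the tie-breaking). **Theorem (Uninformative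 equilibrium).** Suppose that $\psi$ is non-decreasing on $[c_{\min},c_{\max}]$ and that $\ell\le f(c)\le L$ for all $c\in[c_{\min},c_{\max}]$, where $\ell>0$. Then for every number of sellers $K\ge1$, every $M$ and every $\zeta>0$ there exist $\sigma_L<\sigma_H$ with $\sigma_L>\sqrt{\lambda\psi(c_{\max})}$ and $\mu\in(0,1)$ such that, for every mean $\theta$, the profile in which every seller shares zero free samples, together with the buyer running the single-sourcing mechanism at every belief profile, is a $\zeta$-approximate subgame perfect equilibrium. -/

import Mathlib

open MeasureTheory ProbabilityTheory
open scoped ENNReal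

noncomputable section

/-! ### Costs -/

/-- The law of a per-sample cost: density `f` on the interval `[cmin, cmax]`. -/
def costLaw (f : ℝ → ℝ) (cmin cmax : ℝ) : Measure ℝ :=
  (volume.restrict (Set.Icc cmin cmax)).withDensity (fun c => ENNReal.ofReal (f c))

/-- The cumulative distribution function `F` of the cost law. -/
def costCDF (f : ℝ → ℝ) (cmin cmax c : ℝ) : ℝ :=
  (costLaw f cmin cmax).real (Set.Iic c)

/-- The virtual cost `ψ(c) = c + F(c) / f(c)`. -/
def virtualCost (f : ℝ → ℝ) (cmin cmax c : ℝ) : ℝ :=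
  c + costCDF f cmin cmax c / f c

/-- The joint law of the costs of `K` sellers, independent and identically distributed. -/
def costsLaw (f : ℝ → ℝ) (cmin cmax : ℝ) (K : ℕ) : Measure (Fin K → ℝ) :=
  Measure.pi (fun _ => costLaw f cmin cmax)

/-! ### Data quality, free samples and beliefs

The quality of a seller is a Boolean: `false` stands for the standard deviation `σL`
and `true` for the standard deviation `σH`. -/

/-- The standard deviation that belongs to a quality. -/
def qualitySD (σL σH : ℝ) (q : Bool) : ℝ := if q then σH else σL

/-- The law of `m` independent samples from the normal distribution `N(θ, σ ^ 2)`, given the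
quality. -/
def dataKernel (θ σL σH : ℝ) (m : ℕ) : Kernel Bool (Fin m → ℝ) :=
  Kernel.ofFunOfCountable (fun q =>
    Measure.pi (fun _ : Fin m => gaussianReal θ (Real.toNNReal (qualitySD σL σH q ^ 2))))

/-- The (unbiased) sample variance of a dataset; it is the constant `0`, hence carries no
information, when the dataset is empty. -/
def sampleVariance {m : ℕ} (x : Fin m → ℝ) : ℝ :=
  (∑ j, (x j - (∑ k, x k) / m) ^ 2) / ((m : ℝ) - 1)

/-- The sampling distribution of the sample variance of `m` samples, given the quality. -/
def varianceKernel (θ σL σH : ℝ) (m : ℕ) : Kernel Bool ℝ :=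
  (dataKernel θ σL σH m).map sampleVariance

instance instIsMarkovKernelDataKernel (θ σL σH : ℝ) (m : ℕ) :
    IsMarkovKernel (dataKernel θ σL σH m) :=
  ⟨fun q => by
    change IsProbabilityMeasure (Measure.pi (fun _ : Fin m =>
      gaussianReal θ (Real.toNNReal (qualitySD σL σH q ^ 2))))
    infer_instance⟩

instance instIsFiniteKernelVarianceKernel (θ σL σH : ℝ) (m : ℕ) :
    IsFiniteKernel (varianceKernel θ σL σH m) := by
  unfold varianceKernel
  infer_instance

/-- The prior on the quality: `σL` with probability `μ` and `σH` with probability `1 - μ`. -/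
def qualityPrior (μ : unitInterval) : Measure Bool := bernoulliMeasure false true μ

instance instIsProbabilityMeasureQualityPrior (μ : unitInterval) :
    IsProbabilityMeasure (qualityPrior μ) := by
  unfold qualityPrior
  infer_instance

/-- The posterior probability of `σH` after `m` free samples with sample variance `s`,
by Bayes' rule. The law of the sample variance does not depend on the mean `θ`, so neither does
this belief. -/
def belief (θ σL σH : ℝ) (μ : unitInterval) (m : ℕ) (s : ℝ) : ℝ :=
  (posterior (varianceKernel θ σL σH m) (qualityPrior μ) s).real {true}

/-- The mean of the variance `σ ^ 2` under a belief that puts probability `p` on `σH`. -/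
def beliefVar (σL σH p : ℝ) : ℝ := (1 - p) * σL ^ 2 + p * σH ^ 2

/-- The joint law of the free-sample datasets, when seller `j` shares `m j` samples: qualities are
drawn from the prior and datasets given the qualities, independently across sellers. -/
def datasetsLaw {K : ℕ} (θ σL σH : ℝ) (μ : unitInterval) (m : Fin K → ℕ) :
    Measure ((j : Fin K) → Fin (m j) → ℝ) :=
  Measure.pi (fun j => (qualityPrior μ).bind (dataKernel θ σL σH (m j)))

/-- The belief profile (probabilities of `σH`) that is induced by free-sample datasets. -/
def beliefProfile {K : ℕ} (θ σL σH : ℝ) (μ : unitInterval) (m : Fin K → ℕ)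
    (S : (j : Fin K) → Fin (m j) → ℝ) : Fin K → ℝ :=
  fun j => belief θ σL σH μ (m j) (sampleVariance (S j))

/-! ### Direct mechanisms -/

/-- A direct mechanism for `K` sellers (for a given belief profile). For a profile of reported
costs, `alloc` is the lottery over the numbers of samples to purchase from the sellers
(a deterministic allocation rule is a lottery `PMF.pure`), and `pay` the payments. Everyone is
risk neutral in payments, so that only the mean payment given the reports matters. -/
structure Mechanism (K : ℕ) where
  alloc : (Fin K → ℝ) → PMF (Fin K → ℕ)
  pay : (Fin K → ℝ) → Fin K → ℝ

/-- The expected number of samples purchased from seller `i` under a lottery, in `[0, ∞]`. -/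
def meanAllocENN {K : ℕ} (p : PMF (Fin K → ℕ)) (i : Fin K) : ℝ≥0∞ :=
  ∑' n : Fin K → ℕ, p n * (n i : ℝ≥0∞)

/-- The expected number of samples purchased from seller `i` under a lottery. -/
def meanAlloc {K : ℕ} (p : PMF (Fin K → ℕ)) (i : Fin K) : ℝ := (meanAllocENN p i).toReal

/-- The variance `∑ i, w i ^ 2 * v i / n i` of the weighted estimator, where `v i` is the mean
variance of the samples of seller `i`. In `[0, ∞]`, a term is `0` if `w i = 0`, and `∞` if
`w i ≠ 0`, `0 < v i` and `n i = 0`. -/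
def weightedVar {K : ℕ} (v : Fin K → ℝ) (n : Fin K → ℕ) (w : Fin K → ℝ) : ℝ≥0∞ :=
  ∑ i, ENNReal.ofReal (w i ^ 2 * v i) / (n i : ℝ≥0∞)

/-- The variance of the estimator under the buyer's best choice of weights, that is of
`w ≥ 0` with `∑ i, w i = 1`. -/
def estimatorVar {K : ℕ} (v : Fin K → ℝ) (n : Fin K → ℕ) : ℝ≥0∞ :=
  ⨅ w ∈ stdSimplex ℝ (Fin K), weightedVar v n w

/-- The utility of seller `i` with cost `c` when the reported costs are `r`. -/
def sellerUtility {K : ℕ} (A : Mechanism K) (i : Fin K) (c : ℝ) (r : Fin K → ℝ) : ℝ :=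
  A.pay r i - meanAlloc (A.alloc r) i * c

/-- The expected utility of seller `i` with cost `c` and report `r`, when the others report
their costs truthfully. -/
def interimUtility (f : ℝ → ℝ) (cmin cmax : ℝ) {K : ℕ} (A : Mechanism K) (i : Fin K)
    (c r : ℝ) : ℝ :=
  ∫ x, sellerUtility A i c (Function.update x i r) ∂(costsLaw f cmin cmax K)

/-- The expectations in the mechanism design problem are well defined. -/
structure Mechanism.WellDefined (f : ℝ → ℝ) (cmin cmax : ℝ) {K : ℕ} (A : Mechanism K) :
    Prop where
  measurable_alloc : ∀ n, Measurable (fun c => A.alloc c n)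
  measurable_pay : ∀ i, Measurable (fun c => A.pay c i)
  integrable_pay : ∀ i, Integrable (fun c => A.pay c i) (costsLaw f cmin cmax K)
  integrable_interim_pay : ∀ i, ∀ r ∈ Set.Icc cmin cmax,
    Integrable (fun c => A.pay (Function.update c i r) i) (costsLaw f cmin cmax K)
  finite_interim_alloc : ∀ i, ∀ r ∈ Set.Icc cmin cmax,
    ∫⁻ c, meanAllocENN (A.alloc (Function.update c i r)) i ∂(costsLaw f cmin cmax K) ≠ ∞

/-- Feasibility: Bayesian incentive compatibility and interim individual rationality. -/
structure Mechanism.Feasible (f : ℝ → ℝ) (cmin cmax : ℝ) {K : ℕ} (A : Mechanism K) :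
    Prop where
  wellDefined : A.WellDefined f cmin cmax
  incentive_compatible : ∀ i, ∀ c ∈ Set.Icc cmin cmax, ∀ r ∈ Set.Icc cmin cmax,
    interimUtility f cmin cmax A i c r ≤ interimUtility f cmin cmax A i c c
  individually_rational : ∀ i, ∀ c ∈ Set.Icc cmin cmax,
    0 ≤ interimUtility f cmin cmax A i c c

/-- The expected cost (negative of the expected utility) of the buyer: expected variance of the
estimator plus `lam` times the expected total payment. -/
def buyerCost (f : ℝ → ℝ) (cmin cmax lam : ℝ) {K : ℕ} (v : Fin K → ℝ) (A : Mechanism K) :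
    EReal :=
  ((∫⁻ c, ∑' n, A.alloc c n * estimatorVar v n ∂(costsLaw f cmin cmax K) : ℝ≥0∞) : EReal)
    + ((lam * ∫ c, ∑ i, A.pay c i ∂(costsLaw f cmin cmax K) : ℝ) : EReal)

/-- `A` is a `ζ`-approximate solution of the buyer's mechanism design problem: it is feasible, and
its expected buyer cost is at most `1 + ζ` times that of any feasible mechanism. -/
def IsApproxSolution (f : ℝ → ℝ) (cmin cmax lam ζ : ℝ) {K : ℕ} (v : Fin K → ℝ)
    (A : Mechanism K) : Prop :=
  A.Feasible f cmin cmax ∧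
    ∀ B : Mechanism K, B.Feasible f cmin cmax →
      buyerCost f cmin cmax lam v A ≤ ((1 + ζ : ℝ) : EReal) * buyerCost f cmin cmax lam v B

/-! ### The single-sourcing mechanism with rounded-down purchases -/

open Classical in
/-- The sellers that minimize the belief-adjusted virtual cost `v i * ψ (c i)`. -/
def bestSellers (f : ℝ → ℝ) (cmin cmax : ℝ) {K : ℕ} (v c : Fin K → ℝ) : Finset (Fin K) :=
  Finset.univ.filter (fun i => ∀ j,
    v i * virtualCost f cmin cmax (c i) ≤ v j * virtualCost f cmin cmax (c j))

theorem bestSellers_nonempty (f : ℝ → ℝ) (cmin cmax : ℝ) {K : ℕ} [NeZero K]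
    (v c : Fin K → ℝ) : (bestSellers f cmin cmax v c).Nonempty := by
  obtain ⟨i, hi⟩ := Finite.exists_min (fun i => v i * virtualCost f cmin cmax (c i))
  exact ⟨i, by simpa [bestSellers] using hi⟩

/-- The number `⌊√(v i) / √(lam * ψ (c i))⌋` of samples that are purchased from a selected
seller. -/
def purchaseSize (f : ℝ → ℝ) (cmin cmax lam vi ci : ℝ) : ℕ :=
  ⌊√vi / √(lam * virtualCost f cmin cmax ci)⌋₊

/-- The buyer selects one of the best sellers, uniformly at random, and purchases only from this
seller. -/
def singleSourceAlloc (f : ℝ → ℝ) (cmin cmax lam : ℝ) {K : ℕ} [NeZero K] (v c : Fin K → ℝ) :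
    PMF (Fin K → ℕ) :=
  (PMF.uniformOfFinset (bestSellers f cmin cmax v c)
    (bestSellers_nonempty f cmin cmax v c)).map
      (fun i => Pi.single i (purchaseSize f cmin cmax lam (v i) (c i)))

/-- The single-sourcing mechanism for given mean variances `v`, with the payments of Myerson,
`c i * n i (c) + ∫ s in c i..cmax, n i (s, c_{-i})`. -/
def singleSource (f : ℝ → ℝ) (cmin cmax lam : ℝ) {K : ℕ} [NeZero K] (v : Fin K → ℝ) :
    Mechanism K where
  alloc := singleSourceAlloc f cmin cmax lam v
  pay c i :=
    c i * meanAlloc (singleSourceAlloc f cmin cmax lam v c) i +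
      ∫ s in (c i)..cmax,
        meanAlloc (singleSourceAlloc f cmin cmax lam v (Function.update c i s)) i

/-- The buyer's continuation strategy: for each belief profile `p` (probabilities of `σH`), the
single-sourcing mechanism for the mean variances under these beliefs. -/
def singleSourceRule (f : ℝ → ℝ) (cmin cmax lam σL σH : ℝ) (K : ℕ) [NeZero K] :
    (Fin K → ℝ) → Mechanism K :=
  fun p => singleSource f cmin cmax lam (fun i => beliefVar σL σH (p i))

/-! ### The free-sample game -/

/-- The utility of seller `i`, as a function of all costs and of all free-sample datasets, when the
buyer runs the mechanism `R p` at the belief profile `p` and costs are reported truthfully. -/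
def realizedUtility {K : ℕ} (θ σL σH : ℝ) (μ : unitInterval) (R : (Fin K → ℝ) → Mechanism K)
    (m : Fin K → ℕ) (i : Fin K) (z : (Fin K → ℝ) × ((j : Fin K) → Fin (m j) → ℝ)) : ℝ :=
  sellerUtility (R (beliefProfile θ σL σH μ m z.2)) i (z.1 i) z.1

/-- The joint law of all costs and all free-sample datasets. -/
def marketLaw (f : ℝ → ℝ) (cmin cmax θ σL σH : ℝ) (μ : unitInterval) {K : ℕ}
    (m : Fin K → ℕ) : Measure ((Fin K → ℝ) × ((j : Fin K) → Fin (m j) → ℝ)) :=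
  (costsLaw f cmin cmax K).prod (datasetsLaw θ σL σH μ m)

/-- The ex-ante payoff of seller `i` under the free-sample profile `m`. -/
def exAntePayoff (f : ℝ → ℝ) (cmin cmax θ σL σH : ℝ) (μ : unitInterval) {K : ℕ}
    (R : (Fin K → ℝ) → Mechanism K) (m : Fin K → ℕ) (i : Fin K) : ℝ :=
  ∫ z, realizedUtility θ σL σH μ R m i z ∂(marketLaw f cmin cmax θ σL σH μ m)

/-- The possible numbers of free samples: `0, 2, 3, …, M`. -/
def freeSampleSizes (M : ℕ) : Set ℕ := {k | k ≤ M ∧ k ≠ 1}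

/-- The free-sample profile `m` together with the buyer's continuation strategy `R` is a
`ζ`-approximate subgame perfect equilibrium: `R` is `ζ`-approximately optimal at every belief
profile, and no seller gains by a unilateral change of the number of free samples. -/
structure IsApproxSPE (f : ℝ → ℝ) (cmin cmax lam : ℝ) (M : ℕ) (θ σL σH : ℝ)
    (μ : unitInterval) (ζ : ℝ) {K : ℕ} (m : Fin K → ℕ) (R : (Fin K → ℝ) → Mechanism K) :
    Prop where
  solution : ∀ p : Fin K → ℝ, (∀ i, p i ∈ Set.Icc (0 : ℝ) 1) →
    IsApproxSolution f cmin cmax lam ζ (fun i => beliefVar σL σH (p i)) (R p)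
  admissible : ∀ i, m i ∈ freeSampleSizes M
  integrable : ∀ m' : Fin K → ℕ, (∀ i, m' i ∈ freeSampleSizes M) → ∀ i,
    Integrable (realizedUtility θ σL σH μ R m' i) (marketLaw f cmin cmax θ σL σH μ m')
  no_deviation : ∀ i, ∀ k ∈ freeSampleSizes M,
    exAntePayoff f cmin cmax θ σL σH μ R (Function.update m i k) i ≤
      exAntePayoff f cmin cmax θ σL σH μ R m i

end

noncomputable section

/-! Two claims carry the theorem: single sourcing is nearly optimal for the buyer at every belief,
and concealing quality beats revealing it.

Near-optimality. By the envelope theorem and Fubini (`envelope`, `RegularCosts.lintegral_rent`,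
`Mechanism.Feasible.integral_pay`), the expected payment to a seller is the utility of its
highest-cost type plus the expected virtual cost of its samples. The buyer thus pays at least the
virtual cost of the allocation, with equality for single sourcing, where the type `cmax` earns
nothing. For fixed costs and weights `w`, AM-GM gives `w i ^ 2 * v i / n i + lam * ψ i * n i ≥ 2 * w
i * √(lam * v i * ψ i)`. As the weights sum to one, every allocation costs at least `2 * √(lam * min
(v i * ψ i))` (`le_estimatorVar_add`). Buying `√v / √(lam * ψ)` samples from a minimizer would
attain this bound. Rounding down costs a factor of at most `1 + ζ` once that number is at least some
`N ≥ 1 / ζ`, which holds at every belief if `σL ≥ N * √(lam * ψ(cmax))`.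

No deviation. A truthful seller earns its information rent, which is at most `C * √v` for its own
mean variance `v`, whatever the buyer believes of the others. When all sellers look alike, the
expected rent is at least `κ * √v` (`exists_le_integral_rent`). Both constants are independent of
`σL`, `σH` and `μ`. Put `1 - μ = e ^ 2`. Without free samples `√v ≥ e * σH`, so the payoff is at
least of order `e * σH`. With two or more free samples and `σH / σL` large, the sample variance
almost reveals the quality, and the expected square root of the belief is only of order `e ^ 2`
(`lintegral_sqrt_belief_le`). The payoff is then at most of order `σL + e ^ 2 * σH`, which is
smaller for small `e` and large `σH / σL`. This is the concavity of the square root: purchases scale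
with the standard deviation, so the seller prefers the averaged variance to a lottery between its
two values. -/

/-- Resampling one coordinate does not change a product law. -/
theorem measurePreserving_update_pi {K : ℕ} (ν : Measure ℝ) [IsProbabilityMeasure ν] (i : Fin K) :
    MeasurePreserving (fun z : (Fin K → ℝ) × ℝ => Function.update z.1 i z.2)
      ((Measure.pi fun _ => ν).prod ν) (Measure.pi fun _ => ν) := by
  refine ⟨measurable_update', ?_⟩
  refine (Measure.pi_eq fun s hs => ?_).symm
  rw [Measure.map_apply measurable_update' (MeasurableSet.univ_pi hs)]
  have hpre : (fun z : (Fin K → ℝ) × ℝ => Function.update z.1 i z.2) ⁻¹' (Set.univ.pi s) =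
      (Set.univ.pi (Function.update s i Set.univ)) ×ˢ (s i) := by
    ext ⟨x, r⟩
    simp only [Set.mem_preimage, Set.mem_univ_pi, Set.mem_prod]
    constructor
    · intro hx
      refine ⟨fun j => ?_, by simpa using hx i⟩
      by_cases hj : j = i
      · subst hj; simp
      · simpa [hj] using hx j
    · rintro ⟨hx, hr⟩ j
      by_cases hj : j = i
      · subst hj; simpa using hr
      · simpa [hj] using hx j
  rw [hpre, Measure.prod_prod, Measure.pi_pi, ← Finset.mul_prod_erase _ _ (Finset.mem_univ i),
    ← Finset.mul_prod_erase (a := i) Finset.univ (fun j => ν (s j))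
      (Finset.mem_univ i)]
  simp only [Function.update_self, measure_univ, one_mul]
  rw [mul_comm]
  congr 1
  refine Finset.prod_congr rfl fun j hj => ?_
  rw [Function.update_of_ne (Finset.ne_of_mem_erase hj)]

/-! ### Regular cost distributions: resampling one cost, and the information rent. -/

/-- The standing assumptions on the cost density `f`. -/
structure RegularCosts (f : ℝ → ℝ) (cmin cmax l L : ℝ) : Prop where
  cmin_pos : 0 < cmin
  cmin_lt_cmax : cmin < cmax
  measurable_density : Measurable f
  mass : ∫ c in cmin..cmax, f c = 1
  l_pos : 0 < l
  bounds : ∀ c ∈ Set.Icc cmin cmax, l ≤ f c ∧ f c ≤ L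
  mono : MonotoneOn (virtualCost f cmin cmax) (Set.Icc cmin cmax)

namespace RegularCosts

variable {f : ℝ → ℝ} {cmin cmax l L : ℝ}

theorem isProbabilityMeasure_costLaw (h : RegularCosts f cmin cmax l L) :
    IsProbabilityMeasure (costLaw f cmin cmax) := by
  constructor
  -- The upper bound `L` gives integrability, so that the mass given as a Bochner integral becomes
  -- the mass of the measure in `[0, ∞]`.
  have hint : IntegrableOn f (Set.Icc cmin cmax) := by
    refine Measure.integrableOn_of_bounded (M := L) (by simp)
      h.measurable_density.aestronglyMeasurable ?_
    filter_upwards [ae_restrict_mem measurableSet_Icc] with c hc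
    rw [Real.norm_eq_abs, abs_of_nonneg (h.l_pos.le.trans (h.bounds c hc).1)]
    exact (h.bounds c hc).2
  rw [costLaw, withDensity_apply _ MeasurableSet.univ, Measure.restrict_univ,
    ← ofReal_integral_eq_lintegral_ofReal hint, integral_Icc_eq_integral_Ioc,
    ← intervalIntegral.integral_of_le h.cmin_lt_cmax.le, h.mass, ENNReal.ofReal_one]
  filter_upwards [ae_restrict_mem measurableSet_Icc] with c hc
  exact h.l_pos.le.trans (h.bounds c hc).1

theorem isProbabilityMeasure_costsLaw (h : RegularCosts f cmin cmax l L) (K : ℕ) :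
    IsProbabilityMeasure (costsLaw f cmin cmax K) := by
  have := h.isProbabilityMeasure_costLaw
  unfold costsLaw
  infer_instance

theorem ae_costLaw_mem (f : ℝ → ℝ) (cmin cmax : ℝ) :
    ∀ᵐ c ∂(costLaw f cmin cmax), c ∈ Set.Icc cmin cmax :=
  (withDensity_absolutelyContinuous _ _).ae_le (ae_restrict_mem measurableSet_Icc)

theorem ae_costsLaw_mem (h : RegularCosts f cmin cmax l L) (K : ℕ) :
    ∀ᵐ c ∂(costsLaw f cmin cmax K), ∀ i, c i ∈ Set.Icc cmin cmax := by
  have := h.isProbabilityMeasure_costLaw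
  rw [ae_all_iff]
  intro i
  exact (measurePreserving_eval (fun _ : Fin K => costLaw f cmin cmax) i).quasiMeasurePreserving.ae
    (ae_costLaw_mem f cmin cmax)

theorem measurable_costCDF (h : RegularCosts f cmin cmax l L) :
    Measurable (costCDF f cmin cmax) := by
  have := h.isProbabilityMeasure_costLaw
  refine Monotone.measurable fun a b hab => ?_
  exact measureReal_mono (Set.Iic_subset_Iic.2 hab)

theorem measurable_virtualCost (h : RegularCosts f cmin cmax l L) :
    Measurable (virtualCost f cmin cmax) :=
  measurable_id.add (h.measurable_costCDF.div h.measurable_density)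

theorem density_pos (h : RegularCosts f cmin cmax l L) {c : ℝ} (hc : c ∈ Set.Icc cmin cmax) :
    0 < f c := h.l_pos.trans_le (h.bounds c hc).1

theorem cmax_mem (h : RegularCosts f cmin cmax l L) : cmax ∈ Set.Icc cmin cmax :=
  ⟨h.cmin_lt_cmax.le, le_rfl⟩

theorem cmin_mem (h : RegularCosts f cmin cmax l L) : cmin ∈ Set.Icc cmin cmax :=
  ⟨le_rfl, h.cmin_lt_cmax.le⟩

theorem hazard_nonneg (h : RegularCosts f cmin cmax l L) {c : ℝ} (hc : c ∈ Set.Icc cmin cmax) :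
    0 ≤ costCDF f cmin cmax c / f c :=
  div_nonneg measureReal_nonneg (h.density_pos hc).le

theorem cmin_le_virtualCost (h : RegularCosts f cmin cmax l L) {c : ℝ}
    (hc : c ∈ Set.Icc cmin cmax) : cmin ≤ virtualCost f cmin cmax c :=
  hc.1.trans (le_add_of_nonneg_right (h.hazard_nonneg hc))

theorem virtualCost_pos (h : RegularCosts f cmin cmax l L) {c : ℝ}
    (hc : c ∈ Set.Icc cmin cmax) : 0 < virtualCost f cmin cmax c :=
  h.cmin_pos.trans_le (h.cmin_le_virtualCost hc)

theorem virtualCost_le (h : RegularCosts f cmin cmax l L) {c : ℝ}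
    (hc : c ∈ Set.Icc cmin cmax) : virtualCost f cmin cmax c ≤ virtualCost f cmin cmax cmax :=
  h.mono hc h.cmax_mem hc.2

theorem measurePreserving_update (h : RegularCosts f cmin cmax l L) {K : ℕ} (i : Fin K) :
    MeasurePreserving (fun z : (Fin K → ℝ) × ℝ => Function.update z.1 i z.2)
      ((costsLaw f cmin cmax K).prod (costLaw f cmin cmax)) (costsLaw f cmin cmax K) := by
  have := h.isProbabilityMeasure_costLaw
  exact measurePreserving_update_pi (costLaw f cmin cmax) i

/-- Splits an ex-ante expectation into interim ones, averaged over the cost of seller `i`. The inner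
integral still runs over all `K` coordinates; its `i`-th one is overwritten, which matches the form
of `interimUtility`. -/
theorem lintegral_costsLaw_eq (h : RegularCosts f cmin cmax l L) {K : ℕ} (i : Fin K)
    {g : (Fin K → ℝ) → ℝ≥0∞} (hg : Measurable g) :
    ∫⁻ c, g c ∂(costsLaw f cmin cmax K) =
      ∫⁻ r, ∫⁻ x, g (Function.update x i r) ∂(costsLaw f cmin cmax K)
        ∂(costLaw f cmin cmax) := by
  have := h.isProbabilityMeasure_costLaw
  have := h.isProbabilityMeasure_costsLaw K
  rw [← (h.measurePreserving_update i).lintegral_comp hg]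
  exact lintegral_prod_symm' (fun z : (Fin K → ℝ) × ℝ => g (Function.update z.1 i z.2))
    (hg.comp measurable_update')

theorem integral_costsLaw_eq (h : RegularCosts f cmin cmax l L) {K : ℕ} (i : Fin K)
    {g : (Fin K → ℝ) → ℝ} (hg : Integrable g (costsLaw f cmin cmax K)) :
    ∫ c, g c ∂(costsLaw f cmin cmax K) =
      ∫ r, ∫ x, g (Function.update x i r) ∂(costsLaw f cmin cmax K)
        ∂(costLaw f cmin cmax) := by
  have := h.isProbabilityMeasure_costLaw
  have := h.isProbabilityMeasure_costsLaw K
  have hmp := h.measurePreserving_update i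
  have hg' : Integrable g (((costsLaw f cmin cmax K).prod (costLaw f cmin cmax)).map
      (fun z : (Fin K → ℝ) × ℝ => Function.update z.1 i z.2)) := by rwa [hmp.map_eq]
  rw [← integral_prod_symm (fun z : (Fin K → ℝ) × ℝ => g (Function.update z.1 i z.2))
    (hg'.comp_measurable hmp.measurable)]
  conv_lhs => rw [← hmp.map_eq]
  rw [integral_map hmp.measurable.aemeasurable hg'.aestronglyMeasurable]

/-- The information rent of a demand schedule `q`, in terms of the hazard rate `F / f`. -/
theorem lintegral_rent (h : RegularCosts f cmin cmax l L) {q : ℝ → ℝ≥0∞} (hq : Measurable q) :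
    ∫⁻ c, (∫⁻ s in Set.Icc c cmax, q s) ∂(costLaw f cmin cmax) =
      ∫⁻ s, ENNReal.ofReal (costCDF f cmin cmax s / f s) * q s ∂(costLaw f cmin cmax) := by
  have := h.isProbabilityMeasure_costLaw
  -- Tonelli on the triangle `c ≤ s`: integrating out `c` leaves `F s * q s` against Lebesgue
  -- measure, and `F = f * (F / f)` turns this into an integral against the cost law.
  have h1 : ∀ c ∈ Set.Icc cmin cmax, ∫⁻ s in Set.Icc c cmax, q s =
      ∫⁻ s in Set.Icc cmin cmax, (Set.Iic s).indicator (fun _ => q s) c := by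
    intro c hc
    have : ∀ s, (Set.Iic s).indicator (fun _ => q s) c = (Set.Ici c).indicator q s := by
      intro s
      simp [Set.indicator_apply]
    simp_rw [this]
    rw [lintegral_indicator measurableSet_Ici, Measure.restrict_restrict measurableSet_Ici]
    congr 2
    ext s
    simp only [Set.mem_Icc, Set.mem_inter_iff, Set.mem_Ici]
    exact ⟨fun hs => ⟨hs.1, hc.1.trans hs.1, hs.2⟩, fun hs => ⟨hs.1, hs.2.2⟩⟩
  rw [lintegral_congr_ae ((ae_costLaw_mem f cmin cmax).mono h1), lintegral_lintegral_swap]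
  · have h2 : ∀ s, ∫⁻ c, (Set.Iic s).indicator (fun _ => q s) c ∂(costLaw f cmin cmax) =
        q s * costLaw f cmin cmax (Set.Iic s) := by
      intro s
      rw [lintegral_indicator_const measurableSet_Iic]
    simp_rw [h2]
    have hm : Measurable fun s => ENNReal.ofReal (costCDF f cmin cmax s / f s) * q s :=
      ((h.measurable_costCDF.div h.measurable_density).ennreal_ofReal).mul hq
    conv_rhs => rw [costLaw]
    rw [lintegral_withDensity_eq_lintegral_mul _ h.measurable_density.ennreal_ofReal hm]
    refine setLIntegral_congr_fun measurableSet_Icc fun s hs => ?_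
    have hf := h.density_pos hs
    simp only [Pi.mul_apply]
    rw [← mul_assoc, ← ENNReal.ofReal_mul hf.le, mul_div_cancel₀ _ hf.ne', mul_comm, costCDF,
      ofReal_measureReal]
  · have : (Function.uncurry fun c s => (Set.Iic s).indicator (fun _ => q s) c) =
        {z : ℝ × ℝ | z.1 ≤ z.2}.indicator (fun z => q z.2) := by
      ext ⟨c, s⟩
      simp [Set.indicator_apply]
    rw [this]
    exact ((hq.comp measurable_snd).indicator
      (measurableSet_le measurable_fst measurable_snd)).aemeasurable

end RegularCosts

/-! ### Envelope theorem and revenue equivalence -/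

theorem AntitoneOn.intervalIntegrable_of_mem {q : ℝ → ℝ} {a b c r : ℝ}
    (hq : AntitoneOn q (Set.Icc a b)) (hc : c ∈ Set.Icc a b) (hr : r ∈ Set.Icc a b) :
    IntervalIntegrable q volume c r :=
  (hq.mono (Set.uIcc_subset_Icc hc hr)).intervalIntegrable

/-- The constant `q r` is a lower bound of `q` on `[c, r]` and an upper bound on `[r, c]`, so the
inequality holds for both signs of `r - c`. It says that misreporting does not pay when rents are
integrals of an antitone demand. -/
theorem AntitoneOn.sub_mul_le_integral {q : ℝ → ℝ} {a b c r : ℝ}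
    (hq : AntitoneOn q (Set.Icc a b)) (hc : c ∈ Set.Icc a b) (hr : r ∈ Set.Icc a b) :
    (r - c) * q r ≤ ∫ s in c..r, q s := by
  rcases le_total c r with hcr | hcr
  · have := intervalIntegral.integral_mono_on (f := fun _ => q r) (g := q) hcr
      (by simp) (hq.intervalIntegrable_of_mem hc hr)
      (fun s hs => hq ⟨hc.1.trans hs.1, hs.2.trans hr.2⟩ hr hs.2)
    simpa using this
  · have := intervalIntegral.integral_mono_on (f := q) (g := fun _ => q r) hcr
      (hq.intervalIntegrable_of_mem hr hc) (by simp)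
      (fun s hs => hq hr ⟨hr.1.trans hs.1, hs.2.trans hc.2⟩ hs.1)
    rw [intervalIntegral.integral_symm]
    simp only [intervalIntegral.integral_const, smul_eq_mul] at this
    linarith

/-- The envelope theorem for incentive compatible schedules. -/
theorem envelope {U Q : ℝ → ℝ} {a b : ℝ}
    (hU : ∀ c ∈ Set.Icc a b, ∀ r ∈ Set.Icc a b, U r + (r - c) * Q r ≤ U c) :
    AntitoneOn Q (Set.Icc a b) ∧
      ∀ c ∈ Set.Icc a b, U c = U b + ∫ s in c..b, Q s := by
  have hQ : AntitoneOn Q (Set.Icc a b) := by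
    intro c hc r hr hcr
    rcases hcr.eq_or_lt with rfl | hlt
    · exact le_rfl
    · have h1 := hU c hc r hr
      have h2 := hU r hr c hc
      have : (r - c) * Q r ≤ (r - c) * Q c := by linarith
      exact le_of_mul_le_mul_left this (by linarith)
  refine ⟨hQ, ?_⟩
  -- Bisection replaces differentiation. On each half the length is halved, while the drops of `Q`
  -- over the two halves add up to the whole drop, so each round halves the error bound.
  have key : ∀ n : ℕ, ∀ c ∈ Set.Icc a b, ∀ r ∈ Set.Icc a b, c ≤ r →
      |U c - U r - ∫ s in c..r, Q s| ≤ (r - c) * (Q c - Q r) / 2 ^ n := by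
    intro n
    induction n with
    | zero =>
      intro c hc r hr hcr
      have h1 := hU c hc r hr
      have h2 := hU r hr c hc
      have h3 := hQ.sub_mul_le_integral hc hr
      have h4 := hQ.sub_mul_le_integral hr hc
      rw [intervalIntegral.integral_symm] at h4
      rw [pow_zero, div_one, abs_le]
      constructor <;> linarith
    | succ n ih =>
      intro c hc r hr hcr
      have hm : (c + r) / 2 ∈ Set.Icc a b := ⟨by linarith [hc.1, hr.1], by linarith [hc.2, hr.2]⟩
      have h1 := ih c hc _ hm (by linarith)
      have h2 := ih _ hm r hr (by linarith)
      have h3 := intervalIntegral.integral_add_adjacent_intervals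
        (hQ.intervalIntegrable_of_mem hc hm) (hQ.intervalIntegrable_of_mem hm hr)
      have h4 := abs_add_le (U c - U ((c + r) / 2) - ∫ s in c..((c + r) / 2), Q s)
        (U ((c + r) / 2) - U r - ∫ s in ((c + r) / 2)..r, Q s)
      have h5 : U c - U r - ∫ s in c..r, Q s =
          (U c - U ((c + r) / 2) - ∫ s in c..((c + r) / 2), Q s) +
            (U ((c + r) / 2) - U r - ∫ s in ((c + r) / 2)..r, Q s) := by
        rw [← h3]; ring
      rw [h5]
      refine h4.trans ((add_le_add h1 h2).trans (le_of_eq ?_))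
      rw [pow_succ]
      field_simp
      ring
  intro c hc
  have hb : b ∈ Set.Icc a b := ⟨hc.1.trans hc.2, le_rfl⟩
  have h0 : |U c - U b - ∫ s in c..b, Q s| ≤ 0 := by
    refine ge_of_tendsto' (x := Filter.atTop)
      (f := fun n : ℕ => (b - c) * (Q c - Q b) / 2 ^ n) ?_ fun n => key n c hc b hb hc.2
    exact tendsto_const_nhds.div_atTop
      (tendsto_pow_atTop_atTop_of_one_lt (by norm_num : (1 : ℝ) < 2))
  have := abs_nonpos_iff.1 h0
  linarith

theorem measurable_meanAllocENN {α : Type*} [MeasurableSpace α] {K : ℕ}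
    {g : α → PMF (Fin K → ℕ)} (hg : ∀ n, Measurable fun c => g c n) (i : Fin K) :
    Measurable fun c => meanAllocENN (g c) i := by
  unfold meanAllocENN
  exact Measurable.tsum fun n => (hg n).mul_const _

/-- The interim expected number of samples that seller `i` sells after the report `r`. -/
def interimAlloc (f : ℝ → ℝ) (cmin cmax : ℝ) {K : ℕ} (A : Mechanism K) (i : Fin K)
    (r : ℝ) : ℝ≥0∞ :=
  ∫⁻ x, meanAllocENN (A.alloc (Function.update x i r)) i ∂(costsLaw f cmin cmax K)

/-- The interim expected payment to seller `i` after the report `r`. -/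
def interimPay (f : ℝ → ℝ) (cmin cmax : ℝ) {K : ℕ} (A : Mechanism K) (i : Fin K)
    (r : ℝ) : ℝ :=
  ∫ x, A.pay (Function.update x i r) i ∂(costsLaw f cmin cmax K)

variable {f : ℝ → ℝ} {cmin cmax l L lam : ℝ} {K : ℕ} {A : Mechanism K}

theorem Mechanism.WellDefined.measurable_interimAlloc (h : RegularCosts f cmin cmax l L)
    (hA : A.WellDefined f cmin cmax) (i : Fin K) :
    Measurable (interimAlloc f cmin cmax A i) := by
  have := h.isProbabilityMeasure_costsLaw K
  exact Measurable.lintegral_prod_left'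
    (f := fun z : (Fin K → ℝ) × ℝ => meanAllocENN (A.alloc (Function.update z.1 i z.2)) i)
    ((measurable_meanAllocENN hA.measurable_alloc i).comp measurable_update')

theorem Mechanism.WellDefined.interimUtility_eq (hA : A.WellDefined f cmin cmax) (i : Fin K)
    (c : ℝ) {r : ℝ} (hr : r ∈ Set.Icc cmin cmax) :
    interimUtility f cmin cmax A i c r =
      interimPay f cmin cmax A i r - c * (interimAlloc f cmin cmax A i r).toReal := by
  have hm : Measurable fun x : Fin K → ℝ => meanAllocENN (A.alloc (Function.update x i r)) i :=
    (measurable_meanAllocENN hA.measurable_alloc i).comp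
      (measurable_update'.comp (measurable_id.prodMk measurable_const))
  have hfin := hA.finite_interim_alloc i r hr
  have hint : Integrable (fun x : Fin K → ℝ => meanAlloc (A.alloc (Function.update x i r)) i)
      (costsLaw f cmin cmax K) := integrable_toReal_of_lintegral_ne_top hm.aemeasurable hfin
  unfold interimUtility sellerUtility
  rw [integral_sub (hA.integrable_interim_pay i r hr) (hint.mul_const c), integral_mul_const]
  unfold meanAlloc
  rw [integral_toReal hm.aemeasurable (ae_lt_top hm hfin), mul_comm]
  rfl

/-- Revenue equivalence: the expected payment to a seller is the utility of the highest-cost type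
plus the expected virtual cost of the samples. -/
theorem Mechanism.Feasible.integral_pay (h : RegularCosts f cmin cmax l L)
    (hA : A.Feasible f cmin cmax) (i : Fin K) :
    ∫⁻ c, ENNReal.ofReal (virtualCost f cmin cmax (c i)) * meanAllocENN (A.alloc c) i
        ∂(costsLaw f cmin cmax K) ≠ ∞ ∧
    ∫ c, A.pay c i ∂(costsLaw f cmin cmax K) =
      interimUtility f cmin cmax A i cmax cmax +
        (∫⁻ c, ENNReal.ofReal (virtualCost f cmin cmax (c i)) * meanAllocENN (A.alloc c) i
          ∂(costsLaw f cmin cmax K)).toReal := by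
  have := h.isProbabilityMeasure_costsLaw K
  have := h.isProbabilityMeasure_costLaw
  have hwd := hA.wellDefined
  set q := interimAlloc f cmin cmax A i with hq
  have hqm : Measurable q := hwd.measurable_interimAlloc h i
  have hqfin : ∀ r ∈ Set.Icc cmin cmax, q r ≠ ∞ := hwd.finite_interim_alloc i
  set U := fun c => interimUtility f cmin cmax A i c c with hU
  obtain ⟨hanti, henv⟩ := envelope (U := U) (Q := fun r => (q r).toReal) (a := cmin) (b := cmax) (by
    intro c hc r hr
    have := hA.incentive_compatible i c hc r hr
    simp only [hU, hwd.interimUtility_eq i _ hc, hwd.interimUtility_eq i _ hr] at this ⊢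
    rw [← hq] at this ⊢
    linarith)
  -- `W r` is the interim payment after the report `r`, up to the constant utility of the type
  -- `cmax`. It is kept in `[0, ∞]` until its integral is known to be finite.
  set W : ℝ → ℝ≥0∞ := fun r => ENNReal.ofReal r * q r + ∫⁻ s in Set.Icc r cmax, q s with hW
  have hint : ∀ r ∈ Set.Icc cmin cmax, ∫⁻ s in Set.Icc r cmax, q s =
      ENNReal.ofReal (∫ s in r..cmax, (q s).toReal) := by
    intro r hr
    rw [intervalIntegral.integral_of_le hr.2, ← integral_Icc_eq_integral_Ioc,
      ofReal_integral_eq_lintegral_ofReal]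
    · refine setLIntegral_congr_fun measurableSet_Icc fun s hs => ?_
      rw [ENNReal.ofReal_toReal (hqfin s ⟨hr.1.trans hs.1, hs.2⟩)]
    · have := hanti.intervalIntegrable_of_mem hr h.cmax_mem
      rwa [intervalIntegrable_iff_integrableOn_Icc_of_le hr.2] at this
    · exact Filter.Eventually.of_forall fun s => ENNReal.toReal_nonneg
  have hWreal : ∀ r ∈ Set.Icc cmin cmax,
      W r = ENNReal.ofReal (r * (q r).toReal + ∫ s in r..cmax, (q s).toReal) := by
    intro r hr
    have hr0 : 0 ≤ r := h.cmin_pos.le.trans hr.1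
    rw [hW]
    simp only
    rw [hint r hr, ENNReal.ofReal_add (by positivity), ENNReal.ofReal_mul hr0,
      ENNReal.ofReal_toReal (hqfin r hr)]
    exact intervalIntegral.integral_nonneg hr.2 fun s _ => ENNReal.toReal_nonneg
  -- Incentive compatibility makes `q` antitone, so the single finite value `q cmin` bounds
  -- everything.
  have hWbound : ∀ r ∈ Set.Icc cmin cmax, W r ≤
      ENNReal.ofReal cmax * q cmin + q cmin * volume (Set.Icc cmin cmax) := by
    intro r hr
    have hmono : ∀ s ∈ Set.Icc cmin cmax, q s ≤ q cmin := fun s hs =>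
      (ENNReal.toReal_le_toReal (hqfin s hs) (hqfin cmin h.cmin_mem)).1
        (hanti h.cmin_mem hs hs.1)
    refine add_le_add (mul_le_mul' (ENNReal.ofReal_le_ofReal hr.2) (hmono r hr)) ?_
    calc ∫⁻ s in Set.Icc r cmax, q s ≤ ∫⁻ _ in Set.Icc r cmax, q cmin :=
          setLIntegral_mono measurable_const fun s hs => hmono s ⟨hr.1.trans hs.1, hs.2⟩
      _ = q cmin * volume (Set.Icc r cmax) := setLIntegral_const _ _
      _ ≤ _ := by gcongr; exact hr.1
  -- In `ψ = c + F / f`, the first term gives the production cost `r * q r`, and the hazard term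
  -- gives the rent by `lintegral_rent`.
  have hψ : ∫⁻ c, ENNReal.ofReal (virtualCost f cmin cmax (c i)) * meanAllocENN (A.alloc c) i
        ∂(costsLaw f cmin cmax K) = ∫⁻ r, W r ∂(costLaw f cmin cmax) := by
    rw [h.lintegral_costsLaw_eq i (g := fun c => ENNReal.ofReal (virtualCost f cmin cmax (c i)) *
      meanAllocENN (A.alloc c) i) (((h.measurable_virtualCost.comp
      (measurable_pi_apply i)).ennreal_ofReal).mul
        (measurable_meanAllocENN hwd.measurable_alloc i))]
    simp only [Function.update_self]
    have hidq : Measurable fun r => ENNReal.ofReal r * q r := measurable_id.ennreal_ofReal.mul hqm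
    have h1 : ∀ r ∈ Set.Icc cmin cmax, ∫⁻ x, ENNReal.ofReal (virtualCost f cmin cmax r) *
          meanAllocENN (A.alloc (Function.update x i r)) i ∂(costsLaw f cmin cmax K) =
        ENNReal.ofReal r * q r + ENNReal.ofReal (costCDF f cmin cmax r / f r) * q r := by
      intro r hr
      rw [lintegral_const_mul' _ _ ENNReal.ofReal_ne_top, ← add_mul,
        ← ENNReal.ofReal_add (h.cmin_pos.le.trans hr.1) (h.hazard_nonneg hr)]
      rfl
    rw [lintegral_congr_ae ((RegularCosts.ae_costLaw_mem f cmin cmax).mono h1),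
      lintegral_add_left hidq, ← h.lintegral_rent hqm, lintegral_add_left hidq]
  have hWfin : ∫⁻ r, W r ∂(costLaw f cmin cmax) ≠ ∞ := by
    have h1 := hqfin cmin h.cmin_mem
    refine ne_top_of_le_ne_top ?_
      (lintegral_mono_ae ((RegularCosts.ae_costLaw_mem f cmin cmax).mono hWbound))
    rw [lintegral_const, measure_univ, mul_one, Real.volume_Icc]
    exact ENNReal.add_ne_top.2 ⟨ENNReal.mul_ne_top ENNReal.ofReal_ne_top h1,
      ENNReal.mul_ne_top h1 ENNReal.ofReal_ne_top⟩
  have hWnonneg : ∀ r ∈ Set.Icc cmin cmax,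
      0 ≤ r * (q r).toReal + ∫ s in r..cmax, (q s).toReal := fun r hr =>
    add_nonneg (mul_nonneg (h.cmin_pos.le.trans hr.1) ENNReal.toReal_nonneg)
      (intervalIntegral.integral_nonneg hr.2 fun s _ => ENNReal.toReal_nonneg)
  have hWae : AEMeasurable W (costLaw f cmin cmax) := by
    refine AEMeasurable.add (measurable_id.ennreal_ofReal.mul hqm).aemeasurable ?_
    refine Measurable.aemeasurable ?_
    have : (fun r => ∫⁻ s in Set.Icc r cmax, q s) =
        fun r => ∫⁻ s, {z : ℝ × ℝ | z.1 ≤ z.2 ∧ z.2 ≤ cmax}.indicator (fun z => q z.2) (r, s) := by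
      funext r
      rw [← lintegral_indicator measurableSet_Icc]
      rfl
    rw [this]
    refine Measurable.lintegral_prod_right' (f := {z : ℝ × ℝ | z.1 ≤ z.2 ∧ z.2 ≤ cmax}.indicator
      (fun z => q z.2)) ((hqm.comp measurable_snd).indicator ?_)
    exact (measurableSet_le measurable_fst measurable_snd).inter
      (measurableSet_le measurable_snd measurable_const)
  refine ⟨hψ ▸ hWfin, ?_⟩
  rw [hψ, h.integral_costsLaw_eq i (hwd.integrable_pay i)]
  have h1 : ∀ r ∈ Set.Icc cmin cmax, ∫ x, A.pay (Function.update x i r) i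
      ∂(costsLaw f cmin cmax K) = U cmax + (W r).toReal := by
    intro r hr
    have e1 := henv r hr
    have e2 := hwd.interimUtility_eq i r hr
    rw [hWreal r hr, ENNReal.toReal_ofReal (hWnonneg r hr)]
    change interimPay f cmin cmax A i r = _
    simp only [hU] at e1 ⊢
    rw [← hq] at e2
    linarith
  rw [integral_congr_ae ((RegularCosts.ae_costLaw_mem f cmin cmax).mono h1), integral_add
    (integrable_const _) (integrable_toReal_of_lintegral_ne_top hWae hWfin), integral_const,
    integral_toReal hWae (ae_lt_top' hWae hWfin)]
  simp [hU]

/-! ### The virtual cost of the buyer -/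

/-- The expected variance of the estimator plus the virtual cost of the purchased samples. -/
def virtualBuyerCost (f : ℝ → ℝ) (cmin cmax lam : ℝ) {K : ℕ} (v c : Fin K → ℝ)
    (p : PMF (Fin K → ℕ)) : ℝ≥0∞ :=
  ∑' n, p n * (estimatorVar v n +
    ∑ i, ENNReal.ofReal (lam * virtualCost f cmin cmax (c i)) * (n i : ℝ≥0∞))

theorem virtualBuyerCost_eq (f : ℝ → ℝ) (cmin cmax lam : ℝ) {K : ℕ} (v c : Fin K → ℝ)
    (p : PMF (Fin K → ℕ)) :
    virtualBuyerCost f cmin cmax lam v c p = ∑' n, p n * estimatorVar v n +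
      ∑ i, ENNReal.ofReal (lam * virtualCost f cmin cmax (c i)) * meanAllocENN p i := by
  unfold virtualBuyerCost meanAllocENN
  simp_rw [mul_add]
  rw [ENNReal.tsum_add]
  congr 1
  simp_rw [Finset.mul_sum]
  rw [Summable.tsum_finsetSum fun i _ => ENNReal.summable]
  refine Finset.sum_congr rfl fun i _ => ?_
  rw [← ENNReal.tsum_mul_left]
  exact tsum_congr fun n => by ring

theorem two_mul_sqrt_le_add_div {a b n : ℝ} (ha : 0 ≤ a) (hb : 0 ≤ b) (hn : 0 < n) :
    2 * √(a * b) ≤ a / n + b * n := by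
  have h1 : a * b = (a / n) * (b * n) := by field_simp
  rw [h1, Real.sqrt_mul (by positivity)]
  have h2 := Real.sq_sqrt (show 0 ≤ a / n by positivity)
  have h3 := Real.sq_sqrt (show 0 ≤ b * n by positivity)
  nlinarith [sq_nonneg (√(a / n) - √(b * n))]

theorem ofReal_two_mul_sqrt_le (a b : ℝ) (ha : 0 ≤ a) (hb : 0 ≤ b) (n : ℕ) :
    ENNReal.ofReal (2 * √(a * b)) ≤ ENNReal.ofReal a / n + ENNReal.ofReal b * n := by
  -- At `n = 0` the right side is `∞` if `a > 0`; if `a = 0`, then `0 / 0 = 0` and the left side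
  -- vanishes too.
  rcases Nat.eq_zero_or_pos n with rfl | hn
  · rcases ha.eq_or_lt with rfl | ha'
    · simp
    · simp [ENNReal.div_zero, ha']
  · have hn' : (0 : ℝ) < n := by exact_mod_cast hn
    have e : ENNReal.ofReal a / n + ENNReal.ofReal b * n = ENNReal.ofReal (a / n + b * n) := by
      rw [ENNReal.ofReal_add (by positivity) (by positivity), ENNReal.ofReal_div_of_pos hn',
        ENNReal.ofReal_mul hb, ENNReal.ofReal_natCast]
    rw [e]
    exact ENNReal.ofReal_le_ofReal (two_mul_sqrt_le_add_div ha hb hn')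

/-- Every allocation costs at least the continuous optimum for a best seller. -/
theorem le_estimatorVar_add {K : ℕ} {v b : Fin K → ℝ} (hv : ∀ i, 0 ≤ v i) (hb : ∀ i, 0 ≤ b i)
    {j : Fin K} (hj : ∀ i, v j * b j ≤ v i * b i) (n : Fin K → ℕ) :
    ENNReal.ofReal (2 * √(v j * b j)) ≤
      estimatorVar v n + ∑ i, ENNReal.ofReal (b i) * (n i : ℝ≥0∞) := by
  unfold estimatorVar
  rw [ENNReal.iInf_add]
  refine le_iInf fun w => ?_
  rw [ENNReal.iInf_add]
  refine le_iInf fun hw => ?_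
  unfold weightedVar
  rw [← Finset.sum_add_distrib]
  -- The bound is distributed over the sellers in proportion to their weights, so that AM-GM can be
  -- applied to each term alone.
  have hsum : ENNReal.ofReal (2 * √(v j * b j)) =
      ∑ i, ENNReal.ofReal (w i * (2 * √(v j * b j))) := by
    rw [← ENNReal.ofReal_sum_of_nonneg fun i _ => mul_nonneg (hw.1 i) (by positivity),
      ← Finset.sum_mul, hw.2, one_mul]
  rw [hsum]
  refine Finset.sum_le_sum fun i _ => ?_
  refine le_trans (ENNReal.ofReal_le_ofReal ?_)
    (ofReal_two_mul_sqrt_le (w i ^ 2 * v i) (b i) (mul_nonneg (sq_nonneg _) (hv i)) (hb i) (n i))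
  rw [mul_assoc, Real.sqrt_mul (sq_nonneg _), Real.sqrt_sq (hw.1 i)]
  have := mul_le_mul_of_nonneg_left (Real.sqrt_le_sqrt (hj i)) (hw.1 i)
  linarith

theorem le_virtualBuyerCost (h : RegularCosts f cmin cmax l L) (hlam : 0 ≤ lam)
    {v c : Fin K → ℝ} (hv : ∀ i, 0 ≤ v i) (hc : ∀ i, c i ∈ Set.Icc cmin cmax)
    {j : Fin K} (hj : j ∈ bestSellers f cmin cmax v c) (p : PMF (Fin K → ℕ)) :
    ENNReal.ofReal (2 * √(v j * (lam * virtualCost f cmin cmax (c j)))) ≤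
      virtualBuyerCost f cmin cmax lam v c p := by
  have hj' : ∀ i, v j * virtualCost f cmin cmax (c j) ≤ v i * virtualCost f cmin cmax (c i) := by
    simpa [bestSellers] using hj
  have key := le_estimatorVar_add (v := v) (b := fun i => lam * virtualCost f cmin cmax (c i)) hv
    (fun i => mul_nonneg hlam (h.virtualCost_pos (hc i)).le) (j := j) (fun i => by
      have := mul_le_mul_of_nonneg_left (hj' i) hlam
      linarith)
  calc ENNReal.ofReal (2 * √(v j * (lam * virtualCost f cmin cmax (c j))))
      = ∑' n, p n * ENNReal.ofReal (2 * √(v j * (lam * virtualCost f cmin cmax (c j)))) := by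
        rw [ENNReal.tsum_mul_right, p.tsum_coe, one_mul]
    _ ≤ _ := ENNReal.tsum_le_tsum fun n => mul_le_mul' le_rfl (key n)

/-- The cost of the buyer under a feasible mechanism, by revenue equivalence. -/
theorem Mechanism.Feasible.buyerCost_eq (h : RegularCosts f cmin cmax l L) (hlam : 0 ≤ lam)
    {A : Mechanism K} (hA : A.Feasible f cmin cmax) (v : Fin K → ℝ) :
    buyerCost f cmin cmax lam v A =
      ((∫⁻ c, virtualBuyerCost f cmin cmax lam v c (A.alloc c) ∂(costsLaw f cmin cmax K) : ℝ≥0∞) :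
        EReal) + ((lam * ∑ i, interimUtility f cmin cmax A i cmax cmax : ℝ) : EReal) := by
  have hwd := hA.wellDefined
  set Y : Fin K → ℝ≥0∞ := fun i => ∫⁻ c, ENNReal.ofReal (virtualCost f cmin cmax (c i)) *
    meanAllocENN (A.alloc c) i ∂(costsLaw f cmin cmax K) with hY
  have hm : ∀ i, Measurable fun c : Fin K → ℝ => ENNReal.ofReal (virtualCost f cmin cmax (c i)) *
      meanAllocENN (A.alloc c) i := fun i =>
    ((h.measurable_virtualCost.comp (measurable_pi_apply i)).ennreal_ofReal).mul
      (measurable_meanAllocENN hwd.measurable_alloc i)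
  have hYfin : ∀ i, Y i ≠ ∞ := fun i => (hA.integral_pay h i).1
  have hpay : ∫ c, ∑ i, A.pay c i ∂(costsLaw f cmin cmax K) =
      ∑ i, interimUtility f cmin cmax A i cmax cmax + (∑ i, Y i).toReal := by
    rw [integral_finsetSum _ fun i _ => hwd.integrable_pay i,
      ENNReal.toReal_sum fun i _ => hYfin i, ← Finset.sum_add_distrib]
    exact Finset.sum_congr rfl fun i _ => (hA.integral_pay h i).2
  have hcost : ∫⁻ c, virtualBuyerCost f cmin cmax lam v c (A.alloc c) ∂(costsLaw f cmin cmax K) =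
      ∫⁻ c, ∑' n, A.alloc c n * estimatorVar v n ∂(costsLaw f cmin cmax K) +
        ENNReal.ofReal lam * ∑ i, Y i := by
    simp_rw [virtualBuyerCost_eq, ENNReal.ofReal_mul hlam, mul_assoc, ← Finset.mul_sum]
    rw [lintegral_add_right, lintegral_const_mul, lintegral_finsetSum]
    · exact fun i _ => hm i
    · exact Finset.measurable_sum _ fun i _ => hm i
    · exact (Finset.measurable_sum _ fun i _ => hm i).const_mul _
  have hfin : ENNReal.ofReal lam * ∑ i, Y i ≠ ∞ :=
    ENNReal.mul_ne_top ENNReal.ofReal_ne_top (ENNReal.sum_ne_top.2 fun i _ => hYfin i)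
  unfold buyerCost
  rw [hcost, hpay, mul_add, EReal.coe_add, EReal.coe_ennreal_add, add_assoc]
  congr 1
  rw [add_comm]
  congr 1
  rw [← EReal.coe_ennreal_toReal hfin, ENNReal.toReal_mul, ENNReal.toReal_ofReal hlam]

/-! ### The single-sourcing mechanism -/

theorem PMF.tsum_map_mul {α β : Type*} (p : PMF α) (g : α → β) (h : β → ℝ≥0∞) :
    ∑' b, p.map g b * h b = ∑' a, p a * h (g a) := by
  classical
  simp_rw [PMF.map_apply, ← ENNReal.tsum_mul_right]
  rw [ENNReal.tsum_comm]
  refine tsum_congr fun a => ?_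
  rw [tsum_eq_single (g a) fun b hb => by simp [hb]]
  simp

theorem mem_bestSellers {v c : Fin K → ℝ} {i : Fin K} :
    i ∈ bestSellers f cmin cmax v c ↔
      ∀ j, v i * virtualCost f cmin cmax (c i) ≤ v j * virtualCost f cmin cmax (c j) := by
  simp [bestSellers]

/-- The expected number of samples that the single-sourcing mechanism purchases from a seller. -/
def singleSourceDemand (f : ℝ → ℝ) (cmin cmax lam : ℝ) {K : ℕ} (v c : Fin K → ℝ)
    (i : Fin K) : ℝ :=
  open Classical in
  if i ∈ bestSellers f cmin cmax v c then
    ((bestSellers f cmin cmax v c).card : ℝ)⁻¹ * purchaseSize f cmin cmax lam (v i) (c i)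
  else 0

theorem meanAllocENN_singleSourceAlloc [NeZero K] (v c : Fin K → ℝ) (i : Fin K) :
    meanAllocENN (singleSourceAlloc f cmin cmax lam v c) i =
      PMF.uniformOfFinset (bestSellers f cmin cmax v c) (bestSellers_nonempty f cmin cmax v c) i *
        (purchaseSize f cmin cmax lam (v i) (c i) : ℝ≥0∞) := by
  unfold meanAllocENN singleSourceAlloc
  rw [PMF.tsum_map_mul _ _ fun n : Fin K → ℕ => (n i : ℝ≥0∞),
    tsum_eq_single i fun j hj => by simp [Pi.single_eq_of_ne hj.symm]]
  simp

theorem meanAlloc_singleSourceAlloc [NeZero K] (v c : Fin K → ℝ) (i : Fin K) :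
    meanAlloc (singleSourceAlloc f cmin cmax lam v c) i =
      singleSourceDemand f cmin cmax lam v c i := by
  rw [meanAlloc, meanAllocENN_singleSourceAlloc, singleSourceDemand, PMF.uniformOfFinset_apply]
  split_ifs <;> simp

theorem singleSourceDemand_nonneg (v c : Fin K → ℝ) (i : Fin K) :
    0 ≤ singleSourceDemand f cmin cmax lam v c i := by
  unfold singleSourceDemand
  split_ifs <;> positivity

/-- Uses only `ψ ≥ cmin` and that a share is at most one. The bound is free of the other sellers'
beliefs and costs. -/
theorem singleSourceDemand_le (h : RegularCosts f cmin cmax l L) (hlam : 0 < lam)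
    (v c : Fin K → ℝ) {i : Fin K} (hc : c i ∈ Set.Icc cmin cmax) :
    singleSourceDemand f cmin cmax lam v c i ≤ √(v i) / √(lam * cmin) := by
  unfold singleSourceDemand
  split_ifs with hi
  · have h1 : (purchaseSize f cmin cmax lam (v i) (c i) : ℝ) ≤ √(v i) / √(lam * cmin) := by
      refine (Nat.floor_le (by positivity)).trans ?_
      have := h.cmin_pos
      have := h.cmin_le_virtualCost hc
      gcongr
    have h2 : ((bestSellers f cmin cmax v c).card : ℝ)⁻¹ ≤ 1 := by
      refine inv_le_one_of_one_le₀ ?_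
      exact_mod_cast Finset.card_pos.2 ⟨i, hi⟩
    calc _ ≤ 1 * (purchaseSize f cmin cmax lam (v i) (c i) : ℝ) := by gcongr
      _ ≤ _ := by rwa [one_mul]
  · positivity

theorem measurableSet_mem_bestSellers (h : RegularCosts f cmin cmax l L) (i : Fin K) :
    MeasurableSet {z : (Fin K → ℝ) × (Fin K → ℝ) | i ∈ bestSellers f cmin cmax z.1 z.2} := by
  have hm : ∀ j, Measurable fun z : (Fin K → ℝ) × (Fin K → ℝ) =>
      z.1 j * virtualCost f cmin cmax (z.2 j) := fun j =>
    ((measurable_pi_apply j).comp measurable_fst).mul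
      (h.measurable_virtualCost.comp ((measurable_pi_apply j).comp measurable_snd))
  simp only [mem_bestSellers, Set.ofPred_forall]
  exact MeasurableSet.iInter fun j => measurableSet_le (hm i) (hm j)

theorem measurable_purchaseSize (h : RegularCosts f cmin cmax l L) :
    Measurable fun z : ℝ × ℝ => purchaseSize f cmin cmax lam z.1 z.2 := by
  unfold purchaseSize
  have := h.measurable_virtualCost
  refine Nat.measurable_floor.comp ?_
  fun_prop

theorem measurable_card_bestSellers (h : RegularCosts f cmin cmax l L) :
    Measurable fun z : (Fin K → ℝ) × (Fin K → ℝ) => (bestSellers f cmin cmax z.1 z.2).card := by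
  classical
  have : ∀ z : (Fin K → ℝ) × (Fin K → ℝ), (bestSellers f cmin cmax z.1 z.2).card =
      ∑ i, if i ∈ bestSellers f cmin cmax z.1 z.2 then 1 else 0 := fun z => by simp
  simp_rw [this]
  exact Finset.measurable_sum _ fun i _ =>
    Measurable.ite (measurableSet_mem_bestSellers h i) measurable_const measurable_const

theorem measurable_singleSourceDemand (h : RegularCosts f cmin cmax l L) (i : Fin K) :
    Measurable fun z : (Fin K → ℝ) × (Fin K → ℝ) =>
      singleSourceDemand f cmin cmax lam z.1 z.2 i := by
  unfold singleSourceDemand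
  refine Measurable.ite (measurableSet_mem_bestSellers h i) (Measurable.mul ?_ ?_) measurable_const
  · exact (measurable_from_nat.comp (measurable_card_bestSellers h) :
      Measurable ((fun n : ℕ => (n : ℝ)⁻¹) ∘ _))
  · refine (measurable_from_nat (f := fun n : ℕ => (n : ℝ))).comp
      ((measurable_purchaseSize h).comp (Measurable.prodMk ?_ ?_))
    · exact (measurable_pi_apply i).comp measurable_fst
    · exact (measurable_pi_apply i).comp measurable_snd

theorem measurable_singleSourceAlloc [NeZero K] (h : RegularCosts f cmin cmax l L)
    (v : Fin K → ℝ) (n : Fin K → ℕ) :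
    Measurable fun c => singleSourceAlloc f cmin cmax lam v c n := by
  classical
  unfold singleSourceAlloc
  simp_rw [PMF.map_apply, PMF.uniformOfFinset_apply]
  have hv : Measurable fun c : Fin K → ℝ => (v, c) := measurable_const.prodMk measurable_id
  refine Measurable.tsum fun i => Measurable.ite ?_ (Measurable.ite ?_ ?_ measurable_const)
    measurable_const
  · have : Measurable fun c : Fin K → ℝ => purchaseSize f cmin cmax lam (v i) (c i) :=
      (measurable_purchaseSize h).comp (measurable_const.prodMk (measurable_pi_apply i))
    have h2 : Measurable fun c : Fin K → ℝ =>
        (Pi.single i (purchaseSize f cmin cmax lam (v i) (c i)) : Fin K → ℕ) :=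
      (measurable_from_nat (f := fun k : ℕ => (Pi.single i k : Fin K → ℕ))).comp this
    exact measurableSet_eq_fun measurable_const h2
  · exact hv (measurableSet_mem_bestSellers h i)
  · exact (measurable_from_nat (f := fun n : ℕ => (n : ℝ≥0∞)⁻¹)).comp
      ((measurable_card_bestSellers h).comp hv)

/-- If `i` is still a best seller at the higher report, it is one at the lower report, where every
seller tied with it is also tied at the higher one. A lower report thus means at most as many ties,
and a purchase that is no smaller. -/
theorem antitoneOn_singleSourceDemand (h : RegularCosts f cmin cmax l L) (hlam : 0 < lam)
    {v : Fin K → ℝ} (c : Fin K → ℝ) {i : Fin K} (hv : 0 ≤ v i) :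
    AntitoneOn (fun r => singleSourceDemand f cmin cmax lam v (Function.update c i r) i)
      (Set.Icc cmin cmax) := by
  intro r hr s hs hrs
  have hψ := mul_le_mul_of_nonneg_left (h.mono hr hs hrs) hv
  simp only
  by_cases his : i ∈ bestSellers f cmin cmax v (Function.update c i s)
  · rw [mem_bestSellers] at his
    simp only [Function.update_self] at his
    have hir : i ∈ bestSellers f cmin cmax v (Function.update c i r) := by
      rw [mem_bestSellers]
      intro j
      by_cases hj : j = i
      · subst hj; exact le_rfl
      · have := his j
        simp only [Function.update_self, Function.update_of_ne hj] at this ⊢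
        exact hψ.trans this
    have hsub : bestSellers f cmin cmax v (Function.update c i r) ⊆
        bestSellers f cmin cmax v (Function.update c i s) := by
      intro j hj
      rw [mem_bestSellers] at hj ⊢
      by_cases hji : j = i
      · subst hji
        intro k
        simpa using his k
      · intro k
        have h1 := hj i
        have h2 := his k
        simp only [Function.update_self, Function.update_of_ne hji] at h1 ⊢
        exact h1.trans (hψ.trans h2)
    have hcard := Finset.card_le_card hsub
    have hpos := Finset.card_pos.2 ⟨i, hir⟩
    unfold singleSourceDemand
    rw [if_pos hir, if_pos (by rw [mem_bestSellers]; simpa using his)]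
    have h1 : ((bestSellers f cmin cmax v (Function.update c i s)).card : ℝ)⁻¹ ≤
        ((bestSellers f cmin cmax v (Function.update c i r)).card : ℝ)⁻¹ := by
      gcongr
    have h2 : purchaseSize f cmin cmax lam (v i) s ≤ purchaseSize f cmin cmax lam (v i) r := by
      unfold purchaseSize
      refine Nat.floor_le_floor ?_
      have := h.virtualCost_pos hr
      have := h.mono hr hs hrs
      gcongr
    simp only [Function.update_self]
    gcongr
  · have : singleSourceDemand f cmin cmax lam v (Function.update c i s) i = 0 := by
      rw [singleSourceDemand, if_neg his]
    rw [this]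
    exact singleSourceDemand_nonneg _ _ _

/-- The information rent of a seller in the single-sourcing mechanism. -/
def singleSourceRent (f : ℝ → ℝ) (cmin cmax lam : ℝ) {K : ℕ} (v c : Fin K → ℝ) (i : Fin K) : ℝ :=
  ∫ s in (c i)..cmax, singleSourceDemand f cmin cmax lam v (Function.update c i s) i

theorem singleSource_pay [NeZero K] (v c : Fin K → ℝ) (i : Fin K) :
    (singleSource f cmin cmax lam v).pay c i =
      c i * singleSourceDemand f cmin cmax lam v c i + singleSourceRent f cmin cmax lam v c i := by
  simp only [singleSource, meanAlloc_singleSourceAlloc, singleSourceRent]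

/-- At a truthful report the first term vanishes, and exactly the rent remains. -/
theorem sellerUtility_singleSource [NeZero K] (v c : Fin K → ℝ) (i : Fin K) (x : ℝ) :
    sellerUtility (singleSource f cmin cmax lam v) i x c =
      (c i - x) * singleSourceDemand f cmin cmax lam v c i +
        singleSourceRent f cmin cmax lam v c i := by
  rw [sellerUtility, singleSource_pay, singleSource, meanAlloc_singleSourceAlloc]
  ring

theorem measurable_intervalIntegral_param {α : Type*} [MeasurableSpace α] {g : α × ℝ → ℝ}
    (hg : Measurable g) {a : α → ℝ} (ha : Measurable a) (b : ℝ) :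
    Measurable fun x => ∫ s in (a x)..b, g (x, s) := by
  have key : ∀ {p q : α → ℝ}, Measurable p → Measurable q →
      Measurable fun x => ∫ s in Set.Ioc (p x) (q x), g (x, s) := by
    intro p q hp hq
    have e : (fun x => ∫ s in Set.Ioc (p x) (q x), g (x, s)) = fun x =>
        ∫ s, {z : α × ℝ | p z.1 < z.2 ∧ z.2 ≤ q z.1}.indicator g (x, s) := by
      funext x
      rw [← integral_indicator measurableSet_Ioc]
      rfl
    rw [e]
    refine (StronglyMeasurable.integral_prod_right' (f := {z : α × ℝ | p z.1 < z.2 ∧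
      z.2 ≤ q z.1}.indicator g) (hg.indicator ?_).stronglyMeasurable).measurable
    exact (measurableSet_lt (hp.comp measurable_fst) measurable_snd).inter
      (measurableSet_le measurable_snd (hq.comp measurable_fst))
  unfold intervalIntegral
  exact (key ha measurable_const).sub (key measurable_const ha)

theorem measurable_singleSourceDemand_update (h : RegularCosts f cmin cmax l L) (i : Fin K) :
    Measurable fun y : ((Fin K → ℝ) × (Fin K → ℝ)) × ℝ =>
      singleSourceDemand f cmin cmax lam y.1.1 (Function.update y.1.2 i y.2) i := by
  have hup : Measurable fun y : ((Fin K → ℝ) × (Fin K → ℝ)) × ℝ =>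
      (y.1.1, Function.update y.1.2 i y.2) := by
    refine Measurable.prodMk (measurable_fst.comp measurable_fst) ?_
    have h1 : Measurable fun p : (Fin K → ℝ) × ℝ => Function.update p.1 i p.2 := measurable_update'
    have h2 : Measurable fun y : ((Fin K → ℝ) × (Fin K → ℝ)) × ℝ => (y.1.2, y.2) :=
      (measurable_snd.comp measurable_fst).prodMk measurable_snd
    exact h1.comp h2
  have := (measurable_singleSourceDemand (lam := lam) h i).comp hup
  exact this

theorem measurable_singleSourceRent (h : RegularCosts f cmin cmax l L) (i : Fin K) :
    Measurable fun z : (Fin K → ℝ) × (Fin K → ℝ) =>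
      singleSourceRent f cmin cmax lam z.1 z.2 i := by
  have hi : Measurable fun z : (Fin K → ℝ) × (Fin K → ℝ) => z.2 i :=
    (measurable_pi_apply i).comp measurable_snd
  have := measurable_intervalIntegral_param
    (measurable_singleSourceDemand_update (lam := lam) h i) hi cmax
  simpa only [singleSourceRent] using this

theorem singleSourceRent_nonneg (v : Fin K → ℝ) {c : Fin K → ℝ} {i : Fin K}
    (hc : c i ≤ cmax) : 0 ≤ singleSourceRent f cmin cmax lam v c i :=
  intervalIntegral.integral_nonneg hc fun _ _ => singleSourceDemand_nonneg _ _ _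

theorem singleSourceRent_le (h : RegularCosts f cmin cmax l L) (hlam : 0 < lam)
    {v : Fin K → ℝ} {c : Fin K → ℝ} {i : Fin K} (hv : 0 ≤ v i) (hc : c i ∈ Set.Icc cmin cmax) :
    singleSourceRent f cmin cmax lam v c i ≤ (cmax - cmin) / √(lam * cmin) * √(v i) := by
  have h1 := intervalIntegral.integral_mono_on (g := fun _ => √(v i) / √(lam * cmin)) hc.2
    ((antitoneOn_singleSourceDemand h hlam c hv).intervalIntegrable_of_mem hc h.cmax_mem)
    (by simp) (fun s hs => singleSourceDemand_le h hlam v (Function.update c i s) (i := i)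
      (by simpa using ⟨hc.1.trans hs.1, hs.2⟩))
  refine h1.trans ?_
  rw [intervalIntegral.integral_const, smul_eq_mul, div_mul_eq_mul_div, mul_div_assoc]
  have := hc.1
  gcongr

theorem singleSource_pay_mem [NeZero K] (h : RegularCosts f cmin cmax l L) (hlam : 0 < lam)
    {v : Fin K → ℝ} {c : Fin K → ℝ} {i : Fin K} (hv : 0 ≤ v i) (hc : c i ∈ Set.Icc cmin cmax) :
    ‖(singleSource f cmin cmax lam v).pay c i‖ ≤
      cmax * (√(v i) / √(lam * cmin)) + (cmax - cmin) / √(lam * cmin) * √(v i) := by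
  have h0 := h.cmin_pos.le.trans hc.1
  have h1 := singleSourceDemand_nonneg (f := f) (cmin := cmin) (cmax := cmax) (lam := lam) v c i
  rw [singleSource_pay, Real.norm_eq_abs, abs_of_nonneg (add_nonneg (mul_nonneg h0 h1)
    (singleSourceRent_nonneg v hc.2))]
  exact add_le_add (mul_le_mul hc.2 (singleSourceDemand_le h hlam v c hc) h1 (h0.trans hc.2))
    (singleSourceRent_le h hlam hv hc)

theorem singleSource_wellDefined [NeZero K] (h : RegularCosts f cmin cmax l L) (hlam : 0 < lam)
    {v : Fin K → ℝ} (hv : ∀ i, 0 ≤ v i) :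
    (singleSource f cmin cmax lam v).WellDefined f cmin cmax := by
  have := h.isProbabilityMeasure_costsLaw K
  have hpay : ∀ i, Measurable fun c => (singleSource f cmin cmax lam v).pay c i := by
    intro i
    have hm : Measurable fun c : Fin K → ℝ => (v, c) := measurable_const.prodMk measurable_id
    simp_rw [singleSource_pay]
    have h1 := (measurable_singleSourceDemand (lam := lam) h i).comp hm
    have h2 := (measurable_singleSourceRent (lam := lam) h i).comp hm
    exact ((measurable_pi_apply i).mul h1).add h2
  refine ⟨measurable_singleSourceAlloc h v, hpay, fun i => ?_, fun i r hr => ?_, fun i r hr => ?_⟩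
  · refine Integrable.of_bound (hpay i).aestronglyMeasurable
      (cmax * (√(v i) / √(lam * cmin)) + (cmax - cmin) / √(lam * cmin) * √(v i)) ?_
    filter_upwards [h.ae_costsLaw_mem K] with c hc using singleSource_pay_mem h hlam (hv i) (hc i)
  · have hm : Measurable fun c : Fin K → ℝ =>
        (singleSource f cmin cmax lam v).pay (Function.update c i r) i :=
      (hpay i).comp measurable_update_left
    refine Integrable.of_bound hm.aestronglyMeasurable
      (cmax * (√(v i) / √(lam * cmin)) + (cmax - cmin) / √(lam * cmin) * √(v i)) ?_
    filter_upwards with c using singleSource_pay_mem h hlam (hv i) (by simpa using hr)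
  · refine ne_top_of_le_ne_top (b := ENNReal.ofReal (√(v i) / √(lam * cmin)))
      ENNReal.ofReal_ne_top ?_
    have hle : ∀ c, meanAllocENN ((singleSource f cmin cmax lam v).alloc
        (Function.update c i r)) i ≤ ENNReal.ofReal (√(v i) / √(lam * cmin)) := by
      intro c
      have h1 := singleSourceDemand_le h hlam v (Function.update c i r) (i := i) (by simpa using hr)
      rw [← meanAlloc_singleSourceAlloc] at h1
      refine (ENNReal.le_ofReal_iff_toReal_le ?_ (by positivity)).2 h1
      change meanAllocENN (singleSourceAlloc f cmin cmax lam v _) i ≠ ∞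
      rw [meanAllocENN_singleSourceAlloc]
      exact ENNReal.mul_ne_top (PMF.apply_ne_top _ _) (ENNReal.natCast_ne_top _)
    calc _ ≤ ∫⁻ _ : Fin K → ℝ, ENNReal.ofReal (√(v i) / √(lam * cmin)) ∂(costsLaw f cmin cmax K) :=
          lintegral_mono hle
      _ = _ := by simp

/-- The rent of the type `cmax` is an integral over a degenerate interval. Hence the buyer pays no
more than the virtual cost. -/
theorem singleSource_interimUtility_cmax [NeZero K] (v : Fin K → ℝ) (i : Fin K) :
    interimUtility f cmin cmax (singleSource f cmin cmax lam v) i cmax cmax = 0 := by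
  simp [interimUtility, sellerUtility_singleSource, singleSourceRent]

/-- Both constraints hold for each profile of the others' costs, before averaging: `(r - c) * D r ≤
∫ s in c..r, D s` for the antitone demand `D`, and rents are nonnegative. -/
theorem singleSource_feasible [NeZero K] (h : RegularCosts f cmin cmax l L) (hlam : 0 < lam)
    {v : Fin K → ℝ} (hv : ∀ i, 0 ≤ v i) :
    (singleSource f cmin cmax lam v).Feasible f cmin cmax := by
  have hwd := singleSource_wellDefined h hlam hv
  have hint : ∀ i c, ∀ r ∈ Set.Icc cmin cmax, Integrable (fun x =>
      sellerUtility (singleSource f cmin cmax lam v) i c (Function.update x i r))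
      (costsLaw f cmin cmax K) := by
    intro i c r hr
    have hm := (measurable_meanAllocENN hwd.measurable_alloc i).comp
      (measurable_update_left (a := i) (x := r))
    exact (hwd.integrable_interim_pay i r hr).sub ((integrable_toReal_of_lintegral_ne_top
      hm.aemeasurable (hwd.finite_interim_alloc i r hr)).mul_const c)
  refine ⟨hwd, fun i c hc r hr => ?_, fun i c hc => ?_⟩
  · refine integral_mono (hint i c r hr) (hint i c c hc) fun x => ?_
    have hanti := antitoneOn_singleSourceDemand h hlam x (hv i)
    have h1 := hanti.sub_mul_le_integral hc hr
    have h2 := intervalIntegral.integral_add_adjacent_intervals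
      (hanti.intervalIntegrable_of_mem hc hr) (hanti.intervalIntegrable_of_mem hr h.cmax_mem)
    simp only [sellerUtility_singleSource, singleSourceRent, Function.update_self,
      Function.update_idem, sub_self, zero_mul, zero_add]
    linarith
  · refine integral_nonneg fun x => ?_
    simp only [sellerUtility_singleSource, Function.update_self, sub_self, zero_mul, zero_add]
    exact singleSourceRent_nonneg v (by simpa using hc.2)

/-! ### Near-optimality of single sourcing. -/

/-- Rounding down a large continuous optimum is almost optimal. -/
theorem div_floor_add_mul_floor_le {N : ℕ} (hN : 0 < N) {ζ v b : ℝ} (hζ : 1 ≤ ζ * N)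
    (hv : 0 < v) (hb : 0 < b) (hx : N ≤ √v / √b) :
    v / ⌊√v / √b⌋₊ + b * ⌊√v / √b⌋₊ ≤ (1 + ζ) * (2 * √(v * b)) := by
  have hNn : N ≤ ⌊√v / √b⌋₊ := Nat.le_floor hx
  have hN' : (0 : ℝ) < N := by exact_mod_cast hN
  have hn1 : (N : ℝ) ≤ ⌊√v / √b⌋₊ := by exact_mod_cast hNn
  have hle := Nat.floor_le (show 0 ≤ √v / √b by positivity)
  have hlt := Nat.lt_floor_add_one (√v / √b)
  set n : ℝ := (⌊√v / √b⌋₊ : ℝ)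
  have hζ0 : 0 < ζ := by
    by_contra hneg
    have := mul_nonpos_of_nonpos_of_nonneg (not_lt.1 hneg) hN'.le
    linarith
  have hn0 : 0 < n := hN'.trans_le hn1
  have hb' : 0 < √b := Real.sqrt_pos.2 hb
  set x := √v / √b
  have hvx : √v = x * √b := by simp only [x]; field_simp
  have e1 : v = x ^ 2 * b := by
    rw [← Real.sq_sqrt hv.le, hvx, mul_pow, Real.sq_sqrt hb.le]
  have e2 : √(v * b) = x * b := by
    rw [Real.sqrt_mul hv.le, hvx, mul_assoc, Real.mul_self_sqrt hb.le]
  rw [e2, e1]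
  have hζn : 1 ≤ ζ * n := hζ.trans (by gcongr)
  -- `x ^ 2 + n ^ 2 = 2 * x * n + (x - n) ^ 2`, and the rounding error satisfies `(x - n) ^ 2 ≤ 1 ≤
  -- 2 * x ≤ 2 * x * (ζ * n)`.
  have key : x ^ 2 + n ^ 2 ≤ (1 + ζ) * (2 * x) * n := by nlinarith
  have : x ^ 2 * b / n + b * n = b * ((x ^ 2 + n ^ 2) / n) := by field_simp
  rw [this]
  have : (x ^ 2 + n ^ 2) / n ≤ (1 + ζ) * (2 * x) := by rwa [div_le_iff₀ hn0]
  nlinarith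

theorem estimatorVar_single_le (v : Fin K → ℝ) (j : Fin K) (n : ℕ) :
    estimatorVar v (Pi.single j n) ≤ ENNReal.ofReal (v j) / n := by
  refine (iInf₂_le (Pi.single j 1) (single_mem_stdSimplex ℝ j)).trans ?_
  unfold weightedVar
  rw [Finset.sum_eq_single j]
  · simp
  · intro i _ hi
    simp [Pi.single_eq_of_ne hi]
  · simp

/-- Holds cost profile by cost profile: each seller in the tie-breaking lottery attains the AM-GM
lower bound up to `1 + ζ`. The hypothesis at `cmax` suffices because `ψ` is largest there, which
makes the purchase at least `N`. -/
theorem virtualBuyerCost_singleSource_le [NeZero K] (h : RegularCosts f cmin cmax l L)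
    (hlam : 0 < lam) {ζ : ℝ} {N : ℕ} (hN : 0 < N) (hζ : 1 ≤ ζ * N) {v c : Fin K → ℝ}
    (hv : ∀ i, N * √(lam * virtualCost f cmin cmax cmax) ≤ √(v i))
    (hc : ∀ i, c i ∈ Set.Icc cmin cmax) (p : PMF (Fin K → ℕ)) :
    virtualBuyerCost f cmin cmax lam v c (singleSourceAlloc f cmin cmax lam v c) ≤
      ENNReal.ofReal (1 + ζ) * virtualBuyerCost f cmin cmax lam v c p := by
  have hN' : (0 : ℝ) < N := by exact_mod_cast hN
  have hζ0 : 0 < ζ := by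
    by_contra hneg
    have := mul_nonpos_of_nonpos_of_nonneg (not_lt.1 hneg) hN'.le
    linarith
  have hmax : 0 < lam * virtualCost f cmin cmax cmax := mul_pos hlam (h.virtualCost_pos h.cmax_mem)
  have hvpos : ∀ i, 0 < v i := fun i =>
    Real.sqrt_pos.1 ((mul_pos hN' (Real.sqrt_pos.2 hmax)).trans_le (hv i))
  conv_lhs => rw [virtualBuyerCost, singleSourceAlloc, PMF.tsum_map_mul _ _ fun n : Fin K → ℕ =>
    estimatorVar v n + ∑ i, ENNReal.ofReal (lam * virtualCost f cmin cmax (c i)) * (n i : ℝ≥0∞)]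
  have key : ∀ j ∈ bestSellers f cmin cmax v c,
      estimatorVar v (Pi.single j (purchaseSize f cmin cmax lam (v j) (c j))) +
        ∑ i, ENNReal.ofReal (lam * virtualCost f cmin cmax (c i)) *
          (((Pi.single j (purchaseSize f cmin cmax lam (v j) (c j)) : Fin K → ℕ) i : ℕ) : ℝ≥0∞) ≤
      ENNReal.ofReal (1 + ζ) * virtualBuyerCost f cmin cmax lam v c p := by
    intro j hj
    have hb : 0 < lam * virtualCost f cmin cmax (c j) := mul_pos hlam (h.virtualCost_pos (hc j))
    have hx : (N : ℝ) ≤ √(v j) / √(lam * virtualCost f cmin cmax (c j)) := by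
      rw [le_div_iff₀ (Real.sqrt_pos.2 hb)]
      refine le_trans ?_ (hv j)
      have := h.virtualCost_le (hc j)
      gcongr
    have hn : 0 < purchaseSize f cmin cmax lam (v j) (c j) := hN.trans_le (Nat.le_floor hx)
    have hn' : (0 : ℝ) < purchaseSize f cmin cmax lam (v j) (c j) := by exact_mod_cast hn
    refine le_trans (add_le_add (estimatorVar_single_le v j _) le_rfl)
      (le_trans ?_ (mul_le_mul' le_rfl (le_virtualBuyerCost h hlam.le (fun i => (hvpos i).le)
        hc hj p)))
    rw [Finset.sum_eq_single j (fun i _ hi => by simp [Pi.single_eq_of_ne hi]) (by simp),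
      Pi.single_eq_same, ← ENNReal.ofReal_mul (by positivity), ← ENNReal.ofReal_natCast,
      ← ENNReal.ofReal_div_of_pos hn', ← ENNReal.ofReal_mul hb.le,
      ← ENNReal.ofReal_add (by have := hvpos j; positivity) (by positivity)]
    exact ENNReal.ofReal_le_ofReal (div_floor_add_mul_floor_le hN hζ (hvpos j) hb hx)
  calc _ ≤ ∑' j, PMF.uniformOfFinset (bestSellers f cmin cmax v c)
        (bestSellers_nonempty f cmin cmax v c) j *
          (ENNReal.ofReal (1 + ζ) * virtualBuyerCost f cmin cmax lam v c p) := by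
        refine ENNReal.tsum_le_tsum fun j => ?_
        by_cases hj : j ∈ bestSellers f cmin cmax v c
        · exact mul_le_mul' le_rfl (key j hj)
        · simp [hj]
    _ = _ := by rw [ENNReal.tsum_mul_right, PMF.tsum_coe, one_mul]

/-- For a competing mechanism, individual rationality at `cmax` makes the virtual cost a lower bound
of the buyer's cost; for single sourcing the two are equal. The comparison is then pointwise in the
costs. -/
theorem isApproxSolution_singleSource [NeZero K] (h : RegularCosts f cmin cmax l L)
    (hlam : 0 < lam) {ζ : ℝ} {N : ℕ} (hN : 0 < N) (hζ : 1 ≤ ζ * N) {v : Fin K → ℝ}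
    (hv0 : ∀ i, 0 ≤ v i)
    (hv : ∀ i, N * √(lam * virtualCost f cmin cmax cmax) ≤ √(v i)) :
    IsApproxSolution f cmin cmax lam ζ v (singleSource f cmin cmax lam v) := by
  have hζ0 : 0 < ζ := by
    by_contra hneg
    have := mul_nonpos_of_nonpos_of_nonneg (not_lt.1 hneg) (Nat.cast_nonneg (α := ℝ) N)
    linarith
  have hfeas := singleSource_feasible h hlam hv0
  refine ⟨hfeas, fun B hB => ?_⟩
  set X := ∫⁻ c, virtualBuyerCost f cmin cmax lam v c (B.alloc c) ∂(costsLaw f cmin cmax K) with hX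
  have h1 : ∫⁻ c, virtualBuyerCost f cmin cmax lam v c
      ((singleSource f cmin cmax lam v).alloc c) ∂(costsLaw f cmin cmax K) ≤
        ENNReal.ofReal (1 + ζ) * X := by
    rw [hX, ← lintegral_const_mul' _ _ ENNReal.ofReal_ne_top]
    refine lintegral_mono_ae ?_
    filter_upwards [h.ae_costsLaw_mem K] with c hc
    exact virtualBuyerCost_singleSource_le h hlam hN hζ hv hc (B.alloc c)
  have h2 : (X : EReal) ≤ buyerCost f cmin cmax lam v B := by
    rw [hB.buyerCost_eq h hlam.le]
    refine le_add_of_nonneg_right ?_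
    exact_mod_cast mul_nonneg hlam.le
      (Finset.sum_nonneg fun i _ => hB.individually_rational i cmax h.cmax_mem)
  have h3 : ((1 + ζ : ℝ) : EReal) = ((ENNReal.ofReal (1 + ζ) : ℝ≥0∞) : EReal) := by
    rw [EReal.coe_ennreal_ofReal, max_eq_left (by positivity)]
  rw [hfeas.buyerCost_eq h hlam.le]
  simp only [singleSource_interimUtility_cmax, Finset.sum_const_zero, mul_zero, EReal.coe_zero,
    add_zero]
  calc _ ≤ ((ENNReal.ofReal (1 + ζ) * X : ℝ≥0∞) : EReal) := by exact_mod_cast h1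
    _ = ((1 + ζ : ℝ) : EReal) * (X : EReal) := by rw [EReal.coe_ennreal_mul, h3]
    _ ≤ _ := mul_le_mul_of_nonneg_left h2 (by rw [h3]; exact EReal.coe_ennreal_nonneg _)

/-! ### Sample variances and beliefs -/

theorem measurable_sampleVariance (m : ℕ) : Measurable (sampleVariance : (Fin m → ℝ) → ℝ) := by
  unfold sampleVariance
  fun_prop

/-- The law of the sample variance of `m` independent standard normal samples. -/
def stdVarianceLaw (m : ℕ) : Measure ℝ :=
  (Measure.pi fun _ : Fin m => gaussianReal 0 1).map sampleVariance

instance instIsProbabilityMeasureStdVarianceLaw (m : ℕ) :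
    IsProbabilityMeasure (stdVarianceLaw m) :=
  Measure.isProbabilityMeasure_map (measurable_sampleVariance m).aemeasurable

theorem sampleVariance_affine {m : ℕ} (θ σ : ℝ) (x : Fin m → ℝ) :
    sampleVariance (fun j => σ * x j + θ) = σ ^ 2 * sampleVariance x := by
  rcases Nat.eq_zero_or_pos m with rfl | hm
  · simp [sampleVariance]
  · have hm' : (m : ℝ) ≠ 0 := by exact_mod_cast hm.ne'
    unfold sampleVariance
    rw [← mul_div_assoc, Finset.mul_sum]
    congr 1
    refine Finset.sum_congr rfl fun j _ => ?_
    rw [Finset.sum_add_distrib, ← Finset.mul_sum]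
    simp only [Finset.sum_const, Finset.card_univ, Fintype.card_fin, nsmul_eq_mul]
    field_simp
    ring

/-- The mean drops out and quality enters only as a scale factor, so one reference law per sample
size controls both qualities. -/
theorem varianceKernel_apply (θ σL σH : ℝ) (m : ℕ) (q : Bool) :
    varianceKernel θ σL σH m q =
      (stdVarianceLaw m).map fun s => qualitySD σL σH q ^ 2 * s := by
  set σ := qualitySD σL σH q
  have hpi : (Measure.pi fun _ : Fin m => gaussianReal θ (Real.toNNReal (σ ^ 2))) =
      (Measure.pi fun _ : Fin m => gaussianReal 0 1).map fun x j => σ * x j + θ := by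
    have hg : (gaussianReal 0 1).map (fun y => σ * y + θ) =
        gaussianReal θ (Real.toNNReal (σ ^ 2)) := by
      have : (fun y => σ * y + θ) = (· + θ) ∘ (σ * ·) := rfl
      rw [this, ← Measure.map_map (by fun_prop) (by fun_prop), gaussianReal_map_const_mul,
        gaussianReal_map_add_const, mul_zero, zero_add, mul_one]
      congr 1
      ext
      simp [Real.toNNReal_of_nonneg (sq_nonneg σ)]
    have := Measure.pi_map_pi (μ := fun _ : Fin m => gaussianReal 0 1)
      (f := fun _ y => σ * y + θ) (hμ := fun _ => by rw [hg]; infer_instance)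
      (fun _ => by fun_prop)
    rw [this, hg]
  rw [varianceKernel, Kernel.map_apply _ (measurable_sampleVariance m), stdVarianceLaw]
  change (Measure.pi fun _ : Fin m => gaussianReal θ (Real.toNNReal (σ ^ 2))).map _ = _
  rw [hpi, Measure.map_map (measurable_sampleVariance m) (by fun_prop),
    Measure.map_map (by fun_prop) (measurable_sampleVariance m)]
  congr 1
  funext x
  exact sampleVariance_affine θ σ x

theorem eq_of_sampleVariance_nonpos {m : ℕ} (hm : 2 ≤ m) {x : Fin m → ℝ}
    (hx : sampleVariance x ≤ 0) (i j : Fin m) : x i = x j := by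
  have hm' : (2 : ℝ) ≤ m := by exact_mod_cast hm
  have hsum : ∑ j, (x j - (∑ k, x k) / m) ^ 2 ≤ 0 := by
    by_contra hneg
    exact absurd hx (not_le.2 (div_pos (not_le.1 hneg) (by linarith)))
  have hzero := (Finset.sum_eq_zero_iff_of_nonneg fun j _ => sq_nonneg _).1
    (hsum.antisymm (Finset.sum_nonneg fun j _ => sq_nonneg (x j - (∑ k, x k) / m)))
  have := pow_eq_zero_iff two_ne_zero |>.1 (hzero i (Finset.mem_univ i))
  have := pow_eq_zero_iff two_ne_zero |>.1 (hzero j (Finset.mem_univ j))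
  linarith

/-- Given all other coordinates, the resampled coordinate `i` would have to hit the single point `x
j`. -/
theorem pi_eq_coord_null {m : ℕ} (ν : Measure ℝ) [IsProbabilityMeasure ν] [NullSingletonClass ν]
    {i j : Fin m} (hij : i ≠ j) : (Measure.pi fun _ : Fin m => ν) {x | x i = x j} = 0 := by
  have hms : MeasurableSet {x : Fin m → ℝ | x i = x j} :=
    measurableSet_eq_fun (measurable_pi_apply i) (measurable_pi_apply j)
  have hmp := measurePreserving_update_pi (K := m) ν i
  rw [← hmp.measure_preimage hms.nullMeasurableSet,
    Measure.measure_prod_null (hmp.measurable hms)]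
  refine Filter.Eventually.of_forall fun x => ?_
  have : Prod.mk x ⁻¹' ((fun z : (Fin m → ℝ) × ℝ => Function.update z.1 i z.2) ⁻¹'
      {x | x i = x j}) = {x j} := by
    ext r
    simp [Function.update_of_ne hij.symm]
  change ν _ = 0
  rw [this, measure_singleton]

/-- False for one sample, whose variance is always `0`; this is where a single free sample has to be
excluded. -/
theorem stdVarianceLaw_Iic_zero {m : ℕ} (hm : 2 ≤ m) : stdVarianceLaw m (Set.Iic 0) = 0 := by
  have := nullSingletonClass_gaussianReal (μ := 0) one_ne_zero
  rw [stdVarianceLaw, Measure.map_apply (measurable_sampleVariance m) measurableSet_Iic]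
  refine measure_mono_null (fun x hx => ?_) (pi_eq_coord_null (gaussianReal 0 1)
    (i := (⟨0, by omega⟩ : Fin m)) (j := ⟨1, by omega⟩) (by simp))
  exact eq_of_sampleVariance_nonpos hm hx _ _

/-- Uniform tail bounds for the laws of the sample variance. -/
theorem exists_stdVarianceLaw_tails (M : ℕ) {ε : ℝ} (hε : 0 < ε) :
    ∃ T > 0, ∃ η > 0, ∀ m, 2 ≤ m → m ≤ M →
      stdVarianceLaw m (Set.Ioi T) ≤ ENNReal.ofReal ε ∧
        stdVarianceLaw m (Set.Iic η) ≤ ENNReal.ofReal ε := by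
  have h1 : ∀ᶠ T : ℝ in Filter.atTop, ∀ m ∈ Finset.range (M + 1),
      1 - ε < cdf (stdVarianceLaw m) T := by
    rw [Filter.eventually_all_finset]
    intro m _
    exact (tendsto_cdf_atTop (stdVarianceLaw m)).eventually (lt_mem_nhds (by linarith))
  -- Without mass on `(-∞, 0]`, right-continuity of the distribution function at `0` makes it small
  -- at some `η > 0`.
  have h2 : ∀ᶠ η : ℝ in nhdsWithin 0 (Set.Ioi 0), ∀ m ∈ Finset.range (M + 1),
      2 ≤ m → cdf (stdVarianceLaw m) η < ε := by
    rw [Filter.eventually_all_finset]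
    intro m _
    by_cases hm : 2 ≤ m
    · have h0 : cdf (stdVarianceLaw m) 0 = 0 := by
        rw [cdf_eq_real, measureReal_def, stdVarianceLaw_Iic_zero hm, ENNReal.toReal_zero]
      have hc := ((cdf (stdVarianceLaw m)).right_continuous 0).mono_left
        (nhdsWithin_mono 0 Set.Ioi_subset_Ici_self)
      rw [h0] at hc
      filter_upwards [hc.eventually (gt_mem_nhds hε)] with η hη _ using hη
    · exact Filter.Eventually.of_forall fun η hm' => absurd hm' hm
  obtain ⟨T, hT, hT0⟩ := (h1.and (Filter.eventually_gt_atTop 0)).exists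
  obtain ⟨η, hη, hη0⟩ := (h2.and self_mem_nhdsWithin).exists
  refine ⟨T, hT0, η, hη0, fun m hm hmM => ⟨?_, ?_⟩⟩
  · have := hT m (Finset.mem_range.2 (by omega))
    rw [cdf_eq_real] at this
    rw [← Set.compl_Iic, ← ofReal_measureReal, probReal_compl_eq_one_sub measurableSet_Iic]
    exact ENNReal.ofReal_le_ofReal (by linarith)
  · have := hη m (Finset.mem_range.2 (by omega)) hm
    rw [← ofReal_cdf]
    exact ENNReal.ofReal_le_ofReal this.le

theorem qualityPrior_true (μ : unitInterval) :
    qualityPrior μ {true} = ENNReal.ofReal (1 - (μ : ℝ)) := by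
  rw [qualityPrior, bernoulliMeasure_apply_of_notMem_of_mem _ (by simp) (by simp) (by simp)]
  rw [ENNReal.ofReal]
  congr 1
  ext
  simp [Real.coe_toNNReal _ (sub_nonneg.2 μ.2.2)]

theorem belief_mem (θ σL σH : ℝ) (μ : unitInterval) (m : ℕ) (s : ℝ) :
    belief θ σL σH μ m s ∈ Set.Icc (0 : ℝ) 1 :=
  ⟨measureReal_nonneg, measureReal_le_one⟩

theorem measurable_belief (θ σL σH : ℝ) (μ : unitInterval) (m : ℕ) :
    Measurable (belief θ σL σH μ m) :=
  (Kernel.measurable_coe _ (by simp)).ennreal_toReal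

/-- Without free samples, the belief is the prior. -/
theorem belief_zero (θ σL σH : ℝ) (μ : unitInterval) :
    belief θ σL σH μ 0 0 = 1 - (μ : ℝ) := by
  have hκ : varianceKernel θ σL σH 0 = Kernel.const Bool (Measure.dirac 0) := by
    ext1 q
    have : (sampleVariance : (Fin 0 → ℝ) → ℝ) = fun _ => 0 := by
      funext x
      simp [sampleVariance]
    rw [varianceKernel, Kernel.map_apply _ (measurable_sampleVariance 0), this, Measure.map_const,
      Kernel.const_apply]
    simp
  have hcomp : varianceKernel θ σL σH 0 ∘ₘ qualityPrior μ = Measure.dirac 0 := by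
    rw [hκ, Measure.const_comp, measure_univ, one_smul]
  have hae := ae_eq_posterior_of_compProd_eq (κ := varianceKernel θ σL σH 0) (μ := qualityPrior μ)
    (η := Kernel.const ℝ (qualityPrior μ)) (by
      rw [hcomp, hκ, Measure.compProd_const, Measure.compProd_const, Measure.prod_swap])
  -- A posterior is determined only almost everywhere, but the law of the statistic is the point
  -- mass at `0`, so its value at `0` is determined.
  rw [hcomp, Filter.EventuallyEq, ae_dirac_eq, Filter.eventually_pure, Kernel.const_apply] at hae
  rw [belief, ← hae, measureReal_def, qualityPrior_true,
    ENNReal.toReal_ofReal (sub_nonneg.2 μ.2.2)]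

/-- The expected root of the belief is small when the two qualities are well separated. -/
theorem lintegral_sqrt_belief_le {σL σH : ℝ} (hσL : 0 < σL) (hσH : 0 < σH) {μ : unitInterval}
    (hμ : μ < 1) {m : ℕ} {T η : ℝ}
    (hT : stdVarianceLaw m (Set.Ioi T) ≤ ENNReal.ofReal (1 - μ))
    (hη : stdVarianceLaw m (Set.Iic η) ≤ ENNReal.ofReal (1 - μ))
    (hsep : T * σL ^ 2 ≤ η * σH ^ 2) (θ : ℝ) :
    ∫⁻ s, ENNReal.ofReal √(belief θ σL σH μ m s)
      ∂(varianceKernel θ σL σH m ∘ₘ qualityPrior μ) ≤ ENNReal.ofReal (4 * (1 - μ)) := by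
  set κ := varianceKernel θ σL σH m with hκ
  set π := qualityPrior μ with hπ
  have hμ' : (μ : ℝ) < 1 := by exact_mod_cast hμ
  set ε : ℝ := 1 - μ with hε
  have hε0 : 0 < ε := by linarith
  have hmk : ∀ q, κ q Set.univ = 1 := fun q => by
    rw [hκ, varianceKernel_apply, Measure.map_apply (by fun_prop) MeasurableSet.univ]
    simp
  -- The threshold of the test between the qualities: `σL` exceeds it, and `σH` stays below it, with
  -- probability at most `ε` each.
  set t := T * σL ^ 2 with ht
  have hlow : κ false (Set.Ioi t) ≤ ENNReal.ofReal ε := by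
    rw [hκ, varianceKernel_apply, Measure.map_apply (by fun_prop) measurableSet_Ioi]
    refine le_trans (measure_mono fun s hs => ?_) hT
    simp only [qualitySD, Set.mem_preimage, Set.mem_Ioi, Bool.false_eq_true, if_false, ht] at hs ⊢
    rw [mul_comm T] at hs
    exact lt_of_mul_lt_mul_left hs (by positivity)
  have hhigh : κ true (Set.Iic t) ≤ ENNReal.ofReal ε := by
    rw [hκ, varianceKernel_apply, Measure.map_apply (by fun_prop) measurableSet_Iic]
    refine le_trans (measure_mono fun s hs => ?_) hη
    simp only [qualitySD, Set.mem_preimage, Set.mem_Iic, if_true] at hs ⊢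
    have : σH ^ 2 * s ≤ σH ^ 2 * η := hs.trans (by linarith)
    exact le_of_mul_le_mul_left this (by positivity)
  have hνIoi : (κ ∘ₘ π) (Set.Ioi t) ≤ ENNReal.ofReal ε + ENNReal.ofReal ε := by
    rw [Measure.bind_apply measurableSet_Ioi κ.aemeasurable, lintegral_fintype, Fintype.sum_bool,
      hπ, qualityPrior_true]
    refine add_le_add ?_ ?_
    · calc _ ≤ 1 * ENNReal.ofReal (1 - μ) := by
            gcongr
            exact (measure_mono (Set.subset_univ _)).trans (hmk true).le
        _ = _ := one_mul _
    · calc _ ≤ ENNReal.ofReal ε * 1 := by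
            gcongr
            exact prob_le_one
        _ = _ := mul_one _
  -- Bayes' rule: this is the joint probability of `σH` and of a statistic below `t`, that is the
  -- prior `ε` times an error of at most `ε`.
  have hpost : ∫⁻ s in Set.Iic t, (posterior κ π) s {true} ∂(κ ∘ₘ π) ≤
      ENNReal.ofReal ε * ENNReal.ofReal ε := by
    rw [← Measure.compProd_apply_prod measurableSet_Iic (by simp), compProd_posterior_eq_map_swap,
      Measure.map_apply measurable_swap (measurableSet_Iic.prod (by simp)),
      Set.preimage_swap_prod, Measure.compProd_apply_prod (by simp) measurableSet_Iic,
      lintegral_singleton, hπ, qualityPrior_true]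
    gcongr
  -- Above `t` the root is bounded by `1`, below by `√p ≤ ε + p / ε`. The expectation is at most `2ε
  -- + ε + ε ^ 2 / ε = 4ε`.
  have hpt : ∀ s, ENNReal.ofReal √(belief θ σL σH μ m s) ≤
      (Set.Ioi t).indicator 1 s + (ENNReal.ofReal ε + ENNReal.ofReal ε⁻¹ *
        (Set.Iic t).indicator (fun s => (posterior κ π) s {true}) s) := by
    intro s
    have hb := belief_mem θ σL σH μ m s
    rcases lt_or_ge t s with hs | hs
    · rw [Set.indicator_of_mem (Set.mem_Ioi.2 hs)]
      refine le_add_right ?_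
      rw [Pi.one_apply, ← ENNReal.ofReal_one]
      exact ENNReal.ofReal_le_ofReal (Real.sqrt_le_one.2 hb.2)
    · rw [Set.indicator_of_mem (Set.mem_Iic.2 hs)]
      refine le_add_left ?_
      have : (posterior κ π) s {true} = ENNReal.ofReal (belief θ σL σH μ m s) := by
        rw [belief, ofReal_measureReal]
      rw [this, ← ENNReal.ofReal_mul (by positivity), ← ENNReal.ofReal_add hε0.le
        (mul_nonneg (by positivity) hb.1)]
      refine ENNReal.ofReal_le_ofReal ?_
      have h1 := Real.sq_sqrt hb.1
      have h2 : ε * √(belief θ σL σH μ m s) ≤ ε * ε + belief θ σL σH μ m s := by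
        nlinarith [sq_nonneg (ε - √(belief θ σL σH μ m s)), Real.sqrt_nonneg (belief θ σL σH μ m s)]
      have h3 : ε + ε⁻¹ * belief θ σL σH μ m s = (ε * ε + belief θ σL σH μ m s) / ε := by
        field_simp
      rw [h3, le_div_iff₀ hε0]
      linarith
  have hνuniv : (κ ∘ₘ π) Set.univ = 1 := by
    rw [Measure.bind_apply MeasurableSet.univ κ.aemeasurable]
    simp_rw [hmk]
    rw [lintegral_one, measure_univ]
  have hpm : Measurable fun s => (posterior κ π) s {true} := Kernel.measurable_coe _ (by simp)
  calc _ ≤ ∫⁻ s, ((Set.Ioi t).indicator 1 s + (ENNReal.ofReal ε + ENNReal.ofReal ε⁻¹ *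
        (Set.Iic t).indicator (fun s => (posterior κ π) s {true}) s)) ∂(κ ∘ₘ π) :=
        lintegral_mono hpt
    _ = (κ ∘ₘ π) (Set.Ioi t) + (ENNReal.ofReal ε + ENNReal.ofReal ε⁻¹ *
        ∫⁻ s in Set.Iic t, (posterior κ π) s {true} ∂(κ ∘ₘ π)) := by
        rw [lintegral_add_left (measurable_one.indicator measurableSet_Ioi),
          lintegral_indicator_one measurableSet_Ioi, lintegral_add_left measurable_const,
          lintegral_const, hνuniv, mul_one, lintegral_const_mul _ (hpm.indicator measurableSet_Iic),
          lintegral_indicator measurableSet_Iic]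
    _ ≤ (ENNReal.ofReal ε + ENNReal.ofReal ε) + (ENNReal.ofReal ε + ENNReal.ofReal ε⁻¹ *
        (ENNReal.ofReal ε * ENNReal.ofReal ε)) := by gcongr
    _ = ENNReal.ofReal (4 * ε) := by
        rw [← ENNReal.ofReal_mul hε0.le, ← ENNReal.ofReal_mul (by positivity),
          ← ENNReal.ofReal_add hε0.le hε0.le, ← ENNReal.ofReal_add hε0.le (by positivity),
          ← ENNReal.ofReal_add (by positivity) (by positivity)]
        congr 1
        field_simp
        ring

/-! ### Ex-ante payoffs under the single-sourcing mechanism -/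

theorem sq_le_beliefVar {σL σH p : ℝ} (hσL : 0 ≤ σL) (hσ : σL ≤ σH) (hp : p ∈ Set.Icc (0 : ℝ) 1) :
    σL ^ 2 ≤ beliefVar σL σH p := by
  unfold beliefVar
  nlinarith [hp.1, pow_le_pow_left₀ hσL hσ 2]

theorem sqrt_beliefVar_le {σL σH p : ℝ} (hσL : 0 ≤ σL) (hσH : 0 ≤ σH)
    (hp : p ∈ Set.Icc (0 : ℝ) 1) : √(beliefVar σL σH p) ≤ σL + σH * √p := by
  refine Real.sqrt_le_iff.2 ⟨by positivity, ?_⟩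
  have h1 := Real.sq_sqrt hp.1
  have h2 : 0 ≤ σL * (σH * √p) := by positivity
  unfold beliefVar
  nlinarith [hp.1, mul_nonneg hp.1 (sq_nonneg σL)]

theorem beliefVar_nonneg {σL σH p : ℝ} (hp : p ∈ Set.Icc (0 : ℝ) 1) : 0 ≤ beliefVar σL σH p :=
  add_nonneg (mul_nonneg (sub_nonneg.2 hp.2) (sq_nonneg _)) (mul_nonneg hp.1 (sq_nonneg _))

theorem le_costLaw_Icc (h : RegularCosts f cmin cmax l L) {a b : ℝ} (ha : cmin ≤ a)
    (hb : b ≤ cmax) : ENNReal.ofReal (l * (b - a)) ≤ costLaw f cmin cmax (Set.Icc a b) := by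
  have hsub : Set.Icc a b ⊆ Set.Icc cmin cmax := Set.Icc_subset_Icc ha hb
  rw [costLaw, withDensity_apply _ measurableSet_Icc, Measure.restrict_restrict measurableSet_Icc,
    Set.inter_eq_left.2 hsub, ENNReal.ofReal_mul h.l_pos.le, ← Real.volume_Icc,
    ← setLIntegral_const]
  exact setLIntegral_mono h.measurable_density.ennreal_ofReal fun c hc =>
    ENNReal.ofReal_le_ofReal (h.bounds c (hsub hc)).1

theorem half_le_floor {x : ℝ} (hx : 1 ≤ x) : x / 2 ≤ ⌊x⌋₊ := by
  have h1 : (1 : ℝ) ≤ ⌊x⌋₊ := by exact_mod_cast Nat.one_le_floor_iff x |>.2 hx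
  have h2 := Nat.lt_floor_add_one x
  linarith

/-- A seller that all others can only match in cost sells a share of at least `1 / K`. -/
theorem le_singleSourceDemand (h : RegularCosts f cmin cmax l L) (hlam : 0 < lam) {v : ℝ}
    (hv0 : 0 ≤ v) (hv : √(lam * virtualCost f cmin cmax cmax) ≤ √v) {c : Fin K → ℝ} {i : Fin K}
    (hc : ∀ j, c j ∈ Set.Icc cmin cmax) (hi : ∀ j, c i ≤ c j) :
    (2 * K * √(lam * virtualCost f cmin cmax cmax))⁻¹ * √v ≤
      singleSourceDemand f cmin cmax lam (fun _ => v) c i := by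
  have hib : i ∈ bestSellers f cmin cmax (fun _ => v) c :=
    mem_bestSellers.2 fun j => mul_le_mul_of_nonneg_left (h.mono (hc i) (hc j) (hi j)) hv0
  have hcard : ((bestSellers f cmin cmax (fun _ => v) c).card : ℝ) ≤ K := by
    exact_mod_cast (Finset.card_le_univ _).trans_eq (Fintype.card_fin K)
  have hpos : (0 : ℝ) < (bestSellers f cmin cmax (fun _ => v) c).card := by
    exact_mod_cast Finset.card_pos.2 ⟨i, hib⟩
  have hψ := mul_pos hlam (h.virtualCost_pos (hc i))
  have hψ1 : 0 < √(lam * virtualCost f cmin cmax (c i)) := Real.sqrt_pos.2 hψ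
  have hψ2 : √(lam * virtualCost f cmin cmax (c i)) ≤ √(lam * virtualCost f cmin cmax cmax) :=
    Real.sqrt_le_sqrt (mul_le_mul_of_nonneg_left (h.virtualCost_le (hc i)) hlam.le)
  have hfl : √v / √(lam * virtualCost f cmin cmax cmax) / 2 ≤
      purchaseSize f cmin cmax lam v (c i) := by
    refine le_trans ?_ (half_le_floor ((one_le_div hψ1).2 (hψ2.trans hv)))
    gcongr
  rw [singleSourceDemand, if_pos hib]
  calc _ = (K : ℝ)⁻¹ * (√v / √(lam * virtualCost f cmin cmax cmax) / 2) := by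
        rw [mul_inv, mul_inv]; ring
    _ ≤ _ := by gcongr

/-- When the buyer regards all sellers as equally good, the expected rent of a seller is at least
proportional to the standard deviation. -/
theorem exists_le_integral_rent [NeZero K] (h : RegularCosts f cmin cmax l L) (hlam : 0 < lam) :
    ∃ κ > 0, ∀ v, 0 ≤ v → √(lam * virtualCost f cmin cmax cmax) ≤ √v → ∀ i : Fin K,
      κ * √v ≤ ∫ c, singleSourceRent f cmin cmax lam (fun _ => v) c i
        ∂(costsLaw f cmin cmax K) := by
  have := h.isProbabilityMeasure_costLaw
  have := h.isProbabilityMeasure_costsLaw K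
  -- With `i` in the lowest third of the cost interval and all others in the highest, an event of
  -- probability at least `(l * w) ^ K`, seller `i` has the lowest cost at every report in the
  -- middle third. That third alone gives a rent of `w * d * √v`.
  set w := (cmax - cmin) / 3 with hw
  have hw0 : 0 < w := div_pos (sub_pos.2 h.cmin_lt_cmax) (by norm_num)
  have hK : (0 : ℝ) < K := by exact_mod_cast Nat.pos_of_ne_zero (NeZero.ne K)
  have hψ : 0 < √(lam * virtualCost f cmin cmax cmax) :=
    Real.sqrt_pos.2 (mul_pos hlam (h.virtualCost_pos h.cmax_mem))
  set d := (2 * K * √(lam * virtualCost f cmin cmax cmax))⁻¹ with hd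
  have hd0 : 0 < d := by positivity
  have hl := h.l_pos
  refine ⟨(l * w) ^ K * (w * d), by positivity, fun v hv0 hv i => ?_⟩
  set a := cmin + w with ha
  set b := cmax - w with hb
  have hab : b - a = w := by rw [ha, hb, hw]; ring
  set E : Set (Fin K → ℝ) := Set.univ.pi fun j => if j = i then Set.Icc cmin a else Set.Icc b cmax
    with hE
  have hEm : MeasurableSet E := MeasurableSet.univ_pi fun j => by
    split_ifs <;> exact measurableSet_Icc
  have hEprob : ENNReal.ofReal ((l * w) ^ K) ≤ costsLaw f cmin cmax K E := by
    rw [costsLaw, hE, Measure.pi_pi, ENNReal.ofReal_pow (by positivity)]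
    calc ENNReal.ofReal (l * w) ^ K = ∏ _j : Fin K, ENNReal.ofReal (l * w) := by simp
      _ ≤ _ := by
        refine Finset.prod_le_prod' fun j _ => ?_
        split_ifs
        · have := le_costLaw_Icc h (a := cmin) (b := a) le_rfl (by rw [ha, hw]; linarith)
          rwa [show a - cmin = w by rw [ha]; ring] at this
        · have := le_costLaw_Icc h (a := b) (b := cmax) (by rw [hb, hw]; linarith) le_rfl
          rwa [show cmax - b = w by rw [hb]; ring] at this
  have hrent : ∀ c ∈ E, (∀ j, c j ∈ Set.Icc cmin cmax) →
      w * d * √v ≤ singleSourceRent f cmin cmax lam (fun _ => v) c i := by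
    intro c hc hbox
    have hci : c i ∈ Set.Icc cmin a := by simpa using hc i (Set.mem_univ i)
    have hcj : ∀ j, j ≠ i → c j ∈ Set.Icc b cmax := fun j hj => by
      simpa [hj] using hc j (Set.mem_univ j)
    have ham : a ∈ Set.Icc cmin cmax := ⟨by linarith, by linarith⟩
    have hbm : b ∈ Set.Icc cmin cmax := ⟨by linarith, by linarith⟩
    have hanti := antitoneOn_singleSourceDemand h hlam (v := fun _ => v) c (i := i) hv0
    have h1 := intervalIntegral.integral_add_adjacent_intervals
      (hanti.intervalIntegrable_of_mem (hbox i) ham) (hanti.intervalIntegrable_of_mem ham hbm)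
    have h2 := intervalIntegral.integral_add_adjacent_intervals
      (hanti.intervalIntegrable_of_mem (hbox i) hbm)
      (hanti.intervalIntegrable_of_mem hbm h.cmax_mem)
    have h3 : 0 ≤ ∫ s in (c i)..a, singleSourceDemand f cmin cmax lam (fun _ => v)
        (Function.update c i s) i :=
      intervalIntegral.integral_nonneg hci.2 fun _ _ => singleSourceDemand_nonneg _ _ _
    have h4 : 0 ≤ ∫ s in b..cmax, singleSourceDemand f cmin cmax lam (fun _ => v)
        (Function.update c i s) i :=
      intervalIntegral.integral_nonneg hbm.2 fun _ _ => singleSourceDemand_nonneg _ _ _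
    have h5 := intervalIntegral.integral_mono_on (f := fun _ => d * √v) (by linarith : a ≤ b)
      (by simp) (hanti.intervalIntegrable_of_mem ham hbm) (fun s hs => by
        refine le_singleSourceDemand h hlam hv0 hv (fun j => ?_) fun j => ?_
        · by_cases hj : j = i
          · subst hj
            simpa using ⟨ham.1.trans hs.1, hs.2.trans hbm.2⟩
          · simpa [hj] using hbox j
        · by_cases hj : j = i
          · subst hj; exact le_rfl
          · simpa [hj] using hs.2.trans (hcj j hj).1)
    rw [intervalIntegral.integral_const, smul_eq_mul, hab] at h5
    unfold singleSourceRent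
    linarith
  have hm : Measurable fun c : Fin K → ℝ => ((fun _ => v : Fin K → ℝ), c) :=
    measurable_const.prodMk measurable_id
  have hrm := (measurable_singleSourceRent (lam := lam) h i).comp hm
  have hint : Integrable (fun c => singleSourceRent f cmin cmax lam (fun _ => v) c i)
      (costsLaw f cmin cmax K) := by
    refine Integrable.of_bound hrm.aestronglyMeasurable
      ((cmax - cmin) / √(lam * cmin) * √v) ?_
    filter_upwards [h.ae_costsLaw_mem K] with c hc
    rw [Real.norm_eq_abs, abs_of_nonneg (singleSourceRent_nonneg _ (hc i).2)]
    exact singleSourceRent_le h hlam (v := fun _ => v) hv0 (hc i)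
  have hEreal : (l * w) ^ K ≤ (costsLaw f cmin cmax K).real E := by
    rw [measureReal_def, ← ENNReal.ofReal_le_iff_le_toReal (measure_ne_top _ _)]
    exact hEprob
  calc (l * w) ^ K * (w * d) * √v ≤ (costsLaw f cmin cmax K).real E * (w * d * √v) := by
        rw [mul_assoc]; gcongr
    _ = ∫ c, E.indicator (fun _ => w * d * √v) c ∂(costsLaw f cmin cmax K) := by
        rw [integral_indicator_const _ hEm, smul_eq_mul]
    _ ≤ _ := by
        refine integral_mono_ae ((integrable_const _).indicator hEm) hint ?_
        filter_upwards [h.ae_costsLaw_mem K] with c hc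
        by_cases hcE : c ∈ E
        · rw [Set.indicator_of_mem hcE]
          exact hrent c hcE hc
        · rw [Set.indicator_of_notMem hcE]
          exact singleSourceRent_nonneg _ (hc i).2

/-! ### Payoffs in the free-sample game. -/

theorem realizedUtility_singleSourceRule [NeZero K] (θ σL σH : ℝ) (μ : unitInterval)
    (m : Fin K → ℕ) (i : Fin K) (z : (Fin K → ℝ) × ((j : Fin K) → Fin (m j) → ℝ)) :
    realizedUtility θ σL σH μ (singleSourceRule f cmin cmax lam σL σH K) m i z =
      singleSourceRent f cmin cmax lam
        (fun j => beliefVar σL σH (beliefProfile θ σL σH μ m z.2 j)) z.1 i := by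
  rw [realizedUtility, singleSourceRule, sellerUtility_singleSource, sub_self, zero_mul, zero_add]

theorem measurable_realizedUtility [NeZero K] (h : RegularCosts f cmin cmax l L)
    (θ σL σH : ℝ) (μ : unitInterval) (m : Fin K → ℕ) (i : Fin K) :
    Measurable (realizedUtility θ σL σH μ (singleSourceRule f cmin cmax lam σL σH K) m i) := by
  have hv : Measurable fun z : (Fin K → ℝ) × ((j : Fin K) → Fin (m j) → ℝ) =>
      fun j => beliefVar σL σH (beliefProfile θ σL σH μ m z.2 j) := by
    refine measurable_pi_lambda _ fun j => ?_
    have h1 : Measurable fun z : (Fin K → ℝ) × ((j : Fin K) → Fin (m j) → ℝ) =>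
        belief θ σL σH μ (m j) (sampleVariance (z.2 j)) :=
      (measurable_belief θ σL σH μ (m j)).comp ((measurable_sampleVariance (m j)).comp
        ((measurable_pi_apply j).comp measurable_snd))
    exact ((measurable_const.sub h1).mul_const _).add (h1.mul_const _)
  have h2 := (measurable_singleSourceRent (lam := lam) h i).comp (hv.prodMk measurable_fst)
  have e : realizedUtility θ σL σH μ (singleSourceRule f cmin cmax lam σL σH K) m i =
      fun z => singleSourceRent f cmin cmax lam
        (fun j => beliefVar σL σH (beliefProfile θ σL σH μ m z.2 j)) z.1 i :=
    funext fun z => realizedUtility_singleSourceRule θ σL σH μ m i z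
  rw [e]
  exact h2

instance instIsProbabilityMeasureDatasetsLaw (θ σL σH : ℝ) (μ : unitInterval) (m : Fin K → ℕ) :
    IsProbabilityMeasure (datasetsLaw θ σL σH μ m) := by
  unfold datasetsLaw
  infer_instance

theorem isProbabilityMeasure_marketLaw (h : RegularCosts f cmin cmax l L) (θ σL σH : ℝ)
    (μ : unitInterval) (m : Fin K → ℕ) :
    IsProbabilityMeasure (marketLaw f cmin cmax θ σL σH μ m) := by
  have := h.isProbabilityMeasure_costsLaw K
  unfold marketLaw
  infer_instance

theorem ae_marketLaw_mem (h : RegularCosts f cmin cmax l L) (θ σL σH : ℝ)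
    (μ : unitInterval) (m : Fin K → ℕ) :
    ∀ᵐ z ∂(marketLaw f cmin cmax θ σL σH μ m), ∀ i, z.1 i ∈ Set.Icc cmin cmax := by
  have := h.isProbabilityMeasure_costsLaw K
  exact Measure.quasiMeasurePreserving_fst.ae (h.ae_costsLaw_mem K)

theorem realizedUtility_mem [NeZero K] (h : RegularCosts f cmin cmax l L) (hlam : 0 < lam)
    (θ : ℝ) {σL σH : ℝ} (hσL : 0 ≤ σL) (hσH : 0 ≤ σH) (μ : unitInterval) (m : Fin K → ℕ)
    (i : Fin K) {z : (Fin K → ℝ) × ((j : Fin K) → Fin (m j) → ℝ)}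
    (hz : z.1 i ∈ Set.Icc cmin cmax) :
    0 ≤ realizedUtility θ σL σH μ (singleSourceRule f cmin cmax lam σL σH K) m i z ∧
      realizedUtility θ σL σH μ (singleSourceRule f cmin cmax lam σL σH K) m i z ≤
        (cmax - cmin) / √(lam * cmin) *
          (σL + σH * √(belief θ σL σH μ (m i) (sampleVariance (z.2 i)))) := by
  rw [realizedUtility_singleSourceRule]
  refine ⟨singleSourceRent_nonneg _ hz.2, ?_⟩
  have hb := belief_mem θ σL σH μ (m i) (sampleVariance (z.2 i))
  refine (singleSourceRent_le h hlam (beliefVar_nonneg hb) hz).trans ?_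
  have := h.cmin_lt_cmax
  exact mul_le_mul_of_nonneg_left (sqrt_beliefVar_le hσL hσH hb)
    (div_nonneg (by linarith) (Real.sqrt_nonneg _))

theorem integrable_realizedUtility [NeZero K] (h : RegularCosts f cmin cmax l L) (hlam : 0 < lam)
    (θ : ℝ) {σL σH : ℝ} (hσL : 0 ≤ σL) (hσH : 0 ≤ σH) (μ : unitInterval) (m : Fin K → ℕ)
    (i : Fin K) :
    Integrable (realizedUtility θ σL σH μ (singleSourceRule f cmin cmax lam σL σH K) m i)
      (marketLaw f cmin cmax θ σL σH μ m) := by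
  have := isProbabilityMeasure_marketLaw h θ σL σH μ m
  have := h.cmin_lt_cmax
  refine Integrable.of_bound (measurable_realizedUtility h θ σL σH μ m i).aestronglyMeasurable
    ((cmax - cmin) / √(lam * cmin) * (σL + σH * 1)) ?_
  filter_upwards [ae_marketLaw_mem h θ σL σH μ m] with z hz
  obtain ⟨h0, h1⟩ := realizedUtility_mem h hlam θ hσL hσH μ m i (hz i)
  rw [Real.norm_eq_abs, abs_of_nonneg h0]
  refine h1.trans (mul_le_mul_of_nonneg_left ?_ (div_nonneg (by linarith) (Real.sqrt_nonneg _)))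
  have := Real.sqrt_le_one.2 (belief_mem θ σL σH μ (m i) (sampleVariance (z.2 i))).2
  gcongr

theorem map_sampleVariance_marketLaw (h : RegularCosts f cmin cmax l L) (θ σL σH : ℝ)
    (μ : unitInterval) (m : Fin K → ℕ) (i : Fin K) :
    (marketLaw f cmin cmax θ σL σH μ m).map (fun z => sampleVariance (z.2 i)) =
      varianceKernel θ σL σH (m i) ∘ₘ qualityPrior μ := by
  have := h.isProbabilityMeasure_costsLaw K
  have e : (fun z : (Fin K → ℝ) × ((j : Fin K) → Fin (m j) → ℝ) => sampleVariance (z.2 i)) =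
      sampleVariance ∘ (Function.eval i ∘ Prod.snd) := rfl
  rw [e, ← Measure.map_map (measurable_sampleVariance _)
    ((measurable_pi_apply i).comp measurable_snd), ← Measure.map_map (measurable_pi_apply i)
    measurable_snd, marketLaw, (measurePreserving_snd (μ := costsLaw f cmin cmax K)).map_eq,
    datasetsLaw, (measurePreserving_eval _ i).map_eq, varianceKernel,
    Measure.map_comp _ _ (measurable_sampleVariance _)]

/-- A seller's payoff is bounded in terms of the expected root of the belief. -/
theorem exAntePayoff_le [NeZero K] (h : RegularCosts f cmin cmax l L) (hlam : 0 < lam)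
    (θ : ℝ) {σL σH : ℝ} (hσL : 0 ≤ σL) (hσH : 0 ≤ σH) (μ : unitInterval) (m : Fin K → ℕ)
    (i : Fin K) {B : ℝ} (hB : 0 ≤ B)
    (hbel : ∫⁻ s, ENNReal.ofReal √(belief θ σL σH μ (m i) s)
      ∂(varianceKernel θ σL σH (m i) ∘ₘ qualityPrior μ) ≤ ENNReal.ofReal B) :
    exAntePayoff f cmin cmax θ σL σH μ (singleSourceRule f cmin cmax lam σL σH K) m i ≤
      (cmax - cmin) / √(lam * cmin) * (σL + σH * B) := by
  have := isProbabilityMeasure_marketLaw h θ σL σH μ m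
  have hC : 0 ≤ (cmax - cmin) / √(lam * cmin) :=
    div_nonneg (sub_nonneg.2 h.cmin_lt_cmax.le) (Real.sqrt_nonneg _)
  have hsv : Measurable fun z : (Fin K → ℝ) × ((j : Fin K) → Fin (m j) → ℝ) =>
      sampleVariance (z.2 i) :=
    (measurable_sampleVariance (m i)).comp ((measurable_pi_apply i).comp measurable_snd)
  have hg : Measurable fun s => √(belief θ σL σH μ (m i) s) :=
    (measurable_belief θ σL σH μ (m i)).sqrt
  have hgi : Integrable (fun z : (Fin K → ℝ) × ((j : Fin K) → Fin (m j) → ℝ) =>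
      √(belief θ σL σH μ (m i) (sampleVariance (z.2 i))))
      (marketLaw f cmin cmax θ σL σH μ m) := by
    refine Integrable.of_bound (hg.comp hsv).aestronglyMeasurable 1 ?_
    filter_upwards with z
    rw [Real.norm_eq_abs, abs_of_nonneg (Real.sqrt_nonneg _)]
    exact Real.sqrt_le_one.2 (belief_mem _ _ _ _ _ _).2
  have hE : ∫ z, √(belief θ σL σH μ (m i) (sampleVariance (z.2 i)))
      ∂(marketLaw f cmin cmax θ σL σH μ m) ≤ B := by
    rw [integral_eq_lintegral_of_nonneg_ae (Filter.Eventually.of_forall fun z => Real.sqrt_nonneg _)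
      (hg.comp hsv).aestronglyMeasurable]
    refine ENNReal.toReal_le_of_le_ofReal hB ?_
    rw [← map_sampleVariance_marketLaw h, lintegral_map hg.ennreal_ofReal hsv] at hbel
    exact hbel
  calc _ ≤ ∫ z, (cmax - cmin) / √(lam * cmin) *
        (σL + σH * √(belief θ σL σH μ (m i) (sampleVariance (z.2 i))))
        ∂(marketLaw f cmin cmax θ σL σH μ m) := by
        refine integral_mono_ae (integrable_realizedUtility h hlam θ hσL hσH μ m i)
          (((integrable_const _).add (hgi.const_mul _)).const_mul _) ?_
        filter_upwards [ae_marketLaw_mem h θ σL σH μ m] with z hz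
        exact (realizedUtility_mem h hlam θ hσL hσH μ m i (hz i)).2
    _ = (cmax - cmin) / √(lam * cmin) * (σL + σH *
        ∫ z, √(belief θ σL σH μ (m i) (sampleVariance (z.2 i)))
          ∂(marketLaw f cmin cmax θ σL σH μ m)) := by
        rw [integral_const_mul, integral_add (integrable_const _) (hgi.const_mul _),
          integral_const, integral_const_mul]
        simp
    _ ≤ _ := by gcongr

/-- The payoff of a seller when nobody shares free samples. -/
theorem exAntePayoff_zero [NeZero K] (h : RegularCosts f cmin cmax l L)
    (θ σL σH : ℝ) (μ : unitInterval) (i : Fin K) :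
    exAntePayoff f cmin cmax θ σL σH μ (singleSourceRule f cmin cmax lam σL σH K)
        (fun _ : Fin K => 0) i =
      ∫ c, singleSourceRent f cmin cmax lam (fun _ => beliefVar σL σH (1 - μ)) c i
        ∂(costsLaw f cmin cmax K) := by
  have := h.isProbabilityMeasure_costsLaw K
  have hb : ∀ S : (j : Fin K) → Fin 0 → ℝ,
      (fun j => beliefVar σL σH (beliefProfile θ σL σH μ (fun _ : Fin K => 0) S j)) =
        fun _ => beliefVar σL σH (1 - μ) := by
    intro S
    funext j
    rw [beliefProfile, show sampleVariance (S j) = 0 by simp [sampleVariance], belief_zero]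
  unfold exAntePayoff
  simp_rw [realizedUtility_singleSourceRule, hb]
  rw [marketLaw, integral_fun_fst (fun c => singleSourceRent f cmin cmax lam
    (fun _ => beliefVar σL σH (1 - μ)) c i)]
  simp

end

/-! ### Choice of the parameters and the equilibrium. -/

theorem theorem1 (f : ℝ → ℝ) (cmin cmax l L lam : ℝ) (M K : ℕ) [NeZero K]
    (hcmin : 0 < cmin) (hcmax : cmin < cmax) (hlam : 0 < lam)
    (hf_meas : Measurable f)
    (hf_mass : ∫ c in cmin..cmax, f c = 1)
    (hl : 0 < l)
    (hf_bounds : ∀ c ∈ Set.Icc cmin cmax, l ≤ f c ∧ f c ≤ L)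
    (hmono : MonotoneOn (virtualCost f cmin cmax) (Set.Icc cmin cmax))
    (ζ : ℝ) (hζ : 0 < ζ) :
    ∃ (σL σH : ℝ) (μ : unitInterval),
      √(lam * virtualCost f cmin cmax cmax) < σL ∧ σL < σH ∧ 0 < μ ∧ μ < 1 ∧
      ∀ θ : ℝ,
        IsApproxSPE f cmin cmax lam M θ σL σH μ ζ (fun _ : Fin K => 0)
          (singleSourceRule f cmin cmax lam σL σH K) := by
  have h : RegularCosts f cmin cmax l L :=
    ⟨hcmin, hcmax, hf_meas, hf_mass, hl, hf_bounds, hmono⟩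
  obtain ⟨κ, hκ, hrent⟩ := exists_le_integral_rent (K := K) h hlam
  set C := (cmax - cmin) / √(lam * cmin) with hC
  have hC0 : 0 < C := div_pos (sub_pos.2 hcmax) (Real.sqrt_pos.2 (mul_pos hlam hcmin))
  set x := √(lam * virtualCost f cmin cmax cmax) with hx
  have hx0 : 0 < x := Real.sqrt_pos.2 (mul_pos hlam (h.virtualCost_pos h.cmax_mem))
  obtain ⟨n, hn⟩ := exists_nat_ge (1 / ζ)
  set N := n + 1 with hN
  have hζN : 1 ≤ ζ * (N : ℝ) := by
    rw [div_le_iff₀ hζ] at hn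
    rw [hN, Nat.cast_add, Nat.cast_one]
    nlinarith
  -- `e` is the square root of the prior probability of `σH`. The bound `1 / 2` keeps `μ` inside
  -- `(0, 1)`; `κ / (8 * C)` makes `4 * C * e ^ 2 * σH` at most half of `κ * e * σH`. As `μ` is
  -- fixed before the standard deviations, so are the tail constants `T` and `η`.
  set e := min (1 / 2) (κ / (8 * C)) with he
  have he0 : 0 < e := lt_min (by norm_num) (by positivity)
  have he1 : e ≤ 1 / 2 := min_le_left _ _
  have he2 : 8 * C * e ≤ κ := by
    have := min_le_right (1 / 2) (κ / (8 * C))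
    rw [← he, le_div_iff₀ (by positivity)] at this
    linarith
  have hesq0 : 0 < e ^ 2 := by positivity
  have hesq1 : e ^ 2 < 1 := by nlinarith
  have hμ1 : 1 - e ^ 2 ∈ Set.Icc (0 : ℝ) 1 := ⟨by linarith, by linarith⟩
  set μ : unitInterval := ⟨1 - e ^ 2, hμ1⟩ with hμ
  have hμe : 1 - (μ : ℝ) = e ^ 2 := by rw [hμ]; ring
  obtain ⟨T, hT, η, hη, htail⟩ := exists_stdVarianceLaw_tails M (ε := 1 - (μ : ℝ))
    (by rw [hμe]; positivity)
  set σL := ((N : ℝ) + 1) * x with hσL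
  -- The ratio `σH / σL`. Its summands give `σL < σH`, `C * σL ≤ κ * e * σH / 2`, and the separation
  -- of the two laws of the sample variance.
  set ρ := 2 + 2 * C / (κ * e) + T / η with hρ
  set σH := ρ * σL with hσH
  have hN0 : (0 : ℝ) < N := by positivity
  have hσL0 : 0 < σL := by positivity
  have hT1 : 0 < T / η := by positivity
  have hC1 : 0 < 2 * C / (κ * e) := by positivity
  have hρ1 : 2 < ρ := by linarith
  have hσ : σL < σH := lt_mul_of_one_lt_left hσL0 (by linarith)
  have hσH0 : 0 < σH := hσL0.trans hσ
  have hsep : T * σL ^ 2 ≤ η * σH ^ 2 := by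
    have h1 : T / η ≤ ρ ^ 2 := by
      have h0 : T / η ≤ ρ := by linarith
      exact h0.trans (le_self_pow₀ (by linarith) two_ne_zero)
    rw [div_le_iff₀ hη] at h1
    rw [hσH, mul_pow]
    have h2 := mul_le_mul_of_nonneg_right h1 (sq_nonneg σL)
    linarith
  have hρC : 2 * C * σL ≤ κ * e * σH := by
    have h1 : 2 * C / (κ * e) ≤ ρ := by linarith
    rw [div_le_iff₀ (by positivity)] at h1
    have h2 := mul_le_mul_of_nonneg_right h1 hσL0.le
    rw [hσH]
    linarith
  have hxσ : x < σL := by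
    have := mul_pos hN0 hx0
    rw [hσL, add_mul]
    linarith
  have hNx : (N : ℝ) * x ≤ σL := by
    rw [hσL, add_mul]
    linarith
  have hsqrt : ∀ p ∈ Set.Icc (0 : ℝ) 1, σL ≤ √(beliefVar σL σH p) := fun p hp =>
    Real.le_sqrt_of_sq_le (sq_le_beliefVar hσL0.le hσ.le hp)
  refine ⟨σL, σH, μ, hxσ, hσ, ?_, ?_, fun θ => ⟨?_, ?_, ?_, ?_⟩⟩
  · exact Subtype.mk_lt_mk.2 (by linarith)
  · exact Subtype.mk_lt_mk.2 (by linarith)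
  · intro p hp
    refine isApproxSolution_singleSource h hlam (Nat.succ_pos n) hζN
      (fun i => beliefVar_nonneg (hp i)) fun i => ?_
    exact hNx.trans (hsqrt _ (hp i))
  · exact fun i => ⟨Nat.zero_le M, zero_ne_one⟩
  · exact fun m' _ i => integrable_realizedUtility h hlam θ hσL0.le hσH0.le μ m' i
  · intro i k hk
    rcases Nat.eq_zero_or_pos k with rfl | hkpos
    · rw [Function.update_eq_self_iff.2 rfl]
    have hk2 : 2 ≤ k := by
      have := hk.2
      omega
    have hbel := lintegral_sqrt_belief_le hσL0 hσH0 (μ := μ) (Subtype.mk_lt_mk.2 (by linarith))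
      (htail k hk2 hk.1).1 (htail k hk2 hk.1).2 hsep θ
    have hup := exAntePayoff_le h hlam θ hσL0.le hσH0.le μ
      (Function.update (fun _ : Fin K => 0) i k) i (B := 4 * (1 - (μ : ℝ)))
      (by rw [hμe]; positivity) (by rw [Function.update_self]; exact hbel)
    have hp : 1 - (μ : ℝ) ∈ Set.Icc (0 : ℝ) 1 := by
      rw [hμe]; exact ⟨hesq0.le, hesq1.le⟩
    have hlow := hrent (beliefVar σL σH (1 - μ)) (beliefVar_nonneg hp)
      (hxσ.le.trans (hsqrt _ hp)) i
    rw [← exAntePayoff_zero h θ σL σH μ i] at hlow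
    refine hup.trans (le_trans ?_ hlow)
    have hv : e * σH ≤ √(beliefVar σL σH (1 - μ)) := by
      refine Real.le_sqrt_of_sq_le ?_
      rw [hμe, beliefVar, mul_pow]
      have : 0 ≤ (1 - e ^ 2) * σL ^ 2 := mul_nonneg hμ1.1 (sq_nonneg _)
      linarith
    have h1 : κ * (e * σH) ≤ κ * √(beliefVar σL σH (1 - μ)) :=
      mul_le_mul_of_nonneg_left hv hκ.le
    have h2 : 8 * C * e * (e * σH) ≤ κ * (e * σH) :=
      mul_le_mul_of_nonneg_right he2 (by positivity)
    -- What remains is `C * (σL + 4 * e ^ 2 * σH) ≤ κ * e * σH`: each of the two terms on the left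
    -- takes at most half of the right side.
    rw [hμe] at h1 ⊢
    rw [← hC]
    linarith
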